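/- **Setting.** $N$ items are to be permuted by a processor with a small private memory that reads and writes arrays in untrusted (encrypted) memory; an observer sees the sequence of accesses to untrusted memory with their addresses, but not the contents. A shuffle is *oblivious* if, for each $N$, there is a fixed access sequence $T$ that every successful run on every input produces and of which every failing (aborted) run produces an initial segment, and if moreover the distribution of the access sequence is the same for all inputs. Its *private memory* is the largest number of words (one word for each stored item, dummy or bucket index, plus list lengths and $O(1)$ counters) in use at any time of a run, over all inputs and all random choices. **Stash Shuffle** with parameters $B,D,C,S,K,W,Q$, where $BD\ge N$. The input and output arrays are divided into $B$ consecutive buckets of at most $D$ items. The intermediate array has $B$ buckets of $CB+K$ cells. *Distribution.* For each input bucket in turn: draw for each of its slots an independent uniform target in $\{0,\dots,B-1\}$; for each target $j$ move up to $C$ items from the part of the stash belonging to $j$ into an output chunk of capacity $C$ for $j$; read the items of the bucket one by one and put each into the chunk of its target if that is not full, otherwise into the stash (fail if the stash already holds $S$ items); pad all chunks with dummies to length $C$ and write them to the intermediate buckets. Then drain the stash: write to each intermediate bucket $j$ up to $K$ items from the part of the stash belonging to $j$, padded with dummies to length $K$; fail if the stash is not empty. *Compression.* To import an intermediate bucket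 means to load it, to permute it uniformly at random, and to append its non-dummy items to a queue of capacity $WD+Q$ (fail on overflow). To drain an output bucket means to write its (at most $D$) items from the front of the queue (fail on underflow). With $L=\min(W,B)$: import the buckets $0,\dots,L-1$; for $b=L,\dots,B-1$ drain bucket $b-L$ and then import bucket $b$; finally drain the buckets $B-L,\dots,B-1$. **Statement.** There is an oblivious shuffle on $N$ items that uses $N^{1/2+o(1)}$ private memory and whose output distribution is at statistical distance $N^{-\omega(1)}$ from uniform. More precisely, let $\varepsilon=\varepsilon(N)$ be any sequence, eventually positive, with $\ln\ln N/\ln N\ll\varepsilon\ll1$ as $N\to\infty$ (such sequences exist), and run the Stash Shuffle with $$B=\lceil N^{1/2-\varepsilon}\rceil,\quad D=\lceil N/B\rceil,\quad C=\lceil(1+\varepsilon)N^{2\varepsilon}\rceil,\quad S=\lceil N^{1/2+2\varepsilon}\rceil,\quad K=\lceil N^{3\varepsilon}\rceil,\quad W=2,\quad Q=\lceil N^{1/2+\varepsilon}\rceil .$$ Then the shuffle is oblivious for every $N$; its private memory is $N^{1/2+o(1)}$; and there is $g(N)\to\infty$ such that for all large $N$ and every initial arrangement of $N$ distinct items, the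 statistical distance between the distribution of its output (where a failing run outputs a special symbol) and the uniform distribution on the $N!$ arrangements is at most $N^{-g(N)}$. -/

import Mathlib

open Filter Topology Asymptotics

namespace StashShuffle

/-- Parameters of the Stash Shuffle: `B` buckets of at most `D` items, at most `C` items travelling
from an input bucket to an output bucket, a stash of total capacity `S`, `K` extra items per output
bucket for the final stash drain, window size `W`, queue slack `Q`. -/
structure Params where
  B : ℕ
  D : ℕ
  C : ℕ
  S : ℕ
  K : ℕ
  W : ℕ
  Q : ℕ

/-- Size of one bucket of the intermediate array. -/
def Params.midSize (p : Params) : ℕ := p.C * p.B + p.K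

/-- All random choices of one run: for every input bucket, the target bucket of each of its `D`
slots; for every intermediate bucket, the permutation with which it is shuffled. A run samples them
uniformly, so all targets are independent and uniform, as are all the permutations. -/
structure Coins (p : Params) where
  targets : Fin p.B → Fin p.D → Fin p.B
  perms : Fin p.B → Equiv.Perm (Fin p.midSize)

def coinsEquiv (p : Params) :
    Coins p ≃ (Fin p.B → Fin p.D → Fin p.B) × (Fin p.B → Equiv.Perm (Fin p.midSize)) where
  toFun ω := (ω.targets, ω.perms)
  invFun t := ⟨t.1, t.2⟩
  left_inv _ := rfl
  right_inv _ := rfl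

instance (p : Params) : Fintype (Coins p) := Fintype.ofEquiv _ (coinsEquiv p).symm

instance (p : Params) : Nonempty (Coins p) := ⟨⟨fun b _ => b, fun _ => 1⟩⟩

/-- What an observer of the untrusted memory sees: the accesses and their addresses. The contents
of the untrusted memory are encrypted and reveal nothing. -/
inductive Access where
  | readIn (i : ℕ)
  | writeMid (bucket i : ℕ)
  | readMid (bucket i : ℕ)
  | writeOut (i : ℕ)

/-- The private memory. Items have type `α`; in `Option α`, `none` is a dummy item. -/
structure Private (p : Params) (α : Type) where
  /-- the stash, organised by target bucket -/
  stash : Fin p.B → List α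
  /-- the output chunks being assembled, one for each target bucket -/
  chunk : Fin p.B → List (Option α)
  /-- the target buckets of the current input bucket -/
  targets : List (Fin p.B)
  /-- the freshly loaded intermediate bucket -/
  bucket : List (Option α)
  /-- the items waiting to be exported -/
  queue : List α

def Private.empty (p : Params) (α : Type) : Private p α := ⟨fun _ => [], fun _ => [], [], [], []⟩

/-- Number of items in the stash. -/
def Private.stashSize {p : Params} {α : Type} (m : Private p α) : ℕ := ∑ j, (m.stash j).length

/-- Amount of private memory in use, in words: one word for each stored item, dummy or target, one
word for the length of each list, and four words for loop counters and the current item. -/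
def Private.words {p : Params} {α : Type} (m : Private p α) : ℕ :=
  ∑ j, ((m.stash j).length + 1) + ∑ j, ((m.chunk j).length + 1) +
    (m.targets.length + 1) + (m.bucket.length + 1) + (m.queue.length + 1) + 4

/-- State of a run: the untrusted arrays, the accesses to them so far, the private memory, and the
largest amount of private memory used so far. -/
structure State (p : Params) (N : ℕ) (α : Type) where
  inp : Fin N → α
  mid : Fin p.B → ℕ → Option α
  out : Fin N → Option α
  trace : List Access
  priv : Private p α
  peak : ℕ

/-- Procedures; `failure` is FAIL, which aborts the run and keeps the state reached. -/
abbrev Proc (p : Params) (N : ℕ) (α : Type) : Type → Type := OptionT (StateM (State p N α))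

section Procedures

variable {p : Params} {N : ℕ} {α : Type}

/-! Primitive operations. -/

/-- A change of the private memory. -/
def privately (f : Private p α → Private p α) : Proc p N α Unit :=
  modify fun s => { s with priv := f s.priv, peak := max s.peak (f s.priv).words }

def getPrivate : Proc p N α (Private p α) := do return (← get).priv

def readIn (i : Fin N) : Proc p N α α := do
  modify fun s => { s with trace := s.trace ++ [Access.readIn i] }
  return (← get).inp i

def writeMid (j : Fin p.B) (i : ℕ) (x : Option α) : Proc p N α Unit :=
  modify fun s => { s with
    mid := Function.update s.mid j (Function.update (s.mid j) i x)
    trace := s.trace ++ [Access.writeMid j i] }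

def readMid (j : Fin p.B) (i : ℕ) : Proc p N α (Option α) := do
  modify fun s => { s with trace := s.trace ++ [Access.readMid j i] }
  return (← get).mid j i

def writeOut (i : Fin N) (a : α) : Proc p N α Unit :=
  modify fun s => { s with
    out := Function.update s.out i (some a)
    trace := s.trace ++ [Access.writeOut i] }

/-! Distribution phase. -/

/-- Move items from the stash into empty output chunks of capacity `cap`. -/
def unstash (cap : ℕ) : Proc p N α Unit :=
  privately fun m => { m with
    chunk := fun j => ((m.stash j).take cap).map some
    stash := fun j => (m.stash j).drop cap }

/-- Put the item of slot `i` into the output chunk of its target, or into the stash. -/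
def place (i : ℕ) (a : α) : Proc p N α Unit := do
  let m ← getPrivate
  let some t := m.targets[i]? | failure
  if (m.chunk t).length < p.C then
    privately fun m => { m with chunk := Function.update m.chunk t (m.chunk t ++ [some a]) }
  else if m.stashSize < p.S then
    privately fun m => { m with stash := Function.update m.stash t (m.stash t ++ [a]) }
  else
    failure

/-- Pad each output chunk with dummies to length `cap` and write it into the intermediate bucket of
its target, from position `off` on. -/
def flush (cap off : ℕ) : Proc p N α Unit := do
  privately fun m => { m with
    targets := []
    chunk := fun j => m.chunk j ++ List.replicate (cap - (m.chunk j).length) none }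
  (List.finRange p.B).forM fun j =>
    (List.range cap).forM fun i => do
      let m ← getPrivate
      writeMid j (off + i) ((m.chunk j).getD i none)
  privately fun m => { m with chunk := fun _ => [] }

/-- Distribute input bucket `b`, which consists of the positions `b * D + i < N` with `i < D`. -/
def distributeBucket (ω : Coins p) (b : Fin p.B) : Proc p N α Unit := do
  privately fun m => { m with targets := List.ofFn (ω.targets b) }
  unstash p.C
  (List.range p.D).forM fun i =>
    if h : b * p.D + i < N then do
      let a ← readIn ⟨b * p.D + i, h⟩
      place i a
    else
      pure ()
  flush p.C (b * p.C)

def drainStash : Proc p N α Unit := do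
  unstash p.K
  flush p.K (p.C * p.B)

/-! Compression phase. -/

/-- The queue has capacity `W * D + Q`; overflow is a failure. -/
def enqueue (a : α) : Proc p N α Unit := do
  let m ← getPrivate
  if m.queue.length < p.W * p.D + p.Q then
    privately fun m => { m with queue := m.queue ++ [a] }
  else
    failure

/-- Underflow of the queue is a failure. -/
def dequeue : Proc p N α α := do
  let m ← getPrivate
  match m.queue with
  | [] => failure
  | a :: q =>
    privately fun m => { m with queue := q }
    return a

/-- Load intermediate bucket `b`, shuffle it, and enqueue the items that are not dummies. -/
def importIntermediate (ω : Coins p) (b : Fin p.B) : Proc p N α Unit := do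
  (List.range p.midSize).forM fun i => do
    let x ← readMid b i
    privately fun m => { m with bucket := m.bucket ++ [x] }
  privately fun m => { m with
    bucket := List.ofFn fun i : Fin p.midSize => m.bucket.getD (ω.perms b i) none }
  let m ← getPrivate
  m.bucket.forM fun x =>
    match x with
    | none => pure ()
    | some a => enqueue a
  privately fun m => { m with bucket := [] }

/-- Export output bucket `b`, which consists of the positions `b * D + i < N` with `i < D`. -/
def drainQueue (b : ℕ) : Proc p N α Unit :=
  (List.range p.D).forM fun i =>
    if h : b * p.D + i < N then do
      let a ← dequeue
      writeOut ⟨b * p.D + i, h⟩ a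
    else
      pure ()

def compress (ω : Coins p) : Proc p N α Unit := do
  let L := min p.W p.B
  ((List.finRange p.B).take L).forM fun b => importIntermediate ω b
  ((List.finRange p.B).drop L).forM fun b => do
    drainQueue (b - L)
    importIntermediate ω b
  ((List.finRange p.B).drop (p.B - L)).forM fun b => drainQueue b

/-- The Stash Shuffle. -/
def stashShuffle (ω : Coins p) : Proc p N α Unit := do
  (List.finRange p.B).forM fun b => distributeBucket ω b
  drainStash
  let m ← getPrivate
  if m.stashSize = 0 then compress ω else failure

end Procedures

def initialState (p : Params) {N : ℕ} {α : Type} (x : Fin N → α) : State p N α where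
  inp := x
  mid := fun _ _ => none
  out := fun _ => none
  trace := []
  priv := Private.empty p α
  peak := (Private.empty p α).words

/-- The run on input `x` with random choices `ω`: `none` if it failed, and the final state. -/
def run {p : Params} {N : ℕ} {α : Type} (x : Fin N → α) (ω : Coins p) :
    Option Unit × State p N α :=
  (stashShuffle ω).run.run (initialState p x)

/-- The output array, or `none` if the run failed. -/
def output {p : Params} {N : ℕ} {α : Type} (x : Fin N → α) (ω : Coins p) :
    Option (Fin N → Option α) :=
  (run x ω).1.map fun _ => (run x ω).2.out

/-- The sequence of accesses to untrusted memory. -/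
def trace {p : Params} {N : ℕ} {α : Type} (x : Fin N → α) (ω : Coins p) : List Access :=
  (run x ω).2.trace

/-- The largest amount of private memory, in words, in use at any time of the run. -/
def peakMemory {p : Params} {N : ℕ} {α : Type} (x : Fin N → α) (ω : Coins p) : ℕ :=
  (run x ω).2.peak

/-- Private memory needed for `N` items: worst case over inputs and random choices, including
failing runs. (`N` items carry at most `N` different labels.) -/
def privateMemory (p : Params) (N : ℕ) : ℕ :=
  Finset.univ.sup fun xω : (Fin N → Fin N) × Coins p => peakMemory xω.1 xω.2

/-- Obliviousness: there is one fixed access sequence `T` that every successful run on every input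
produces, and of which every failing run produces an initial segment; and the distribution of the
access sequence does not depend on the input. -/
def Oblivious (p : Params) (N : ℕ) : Prop :=
  (∃ T : List Access, ∀ (α : Type) (x : Fin N → α) (ω : Coins p),
    trace x ω <+: T ∧ ((output x ω).isSome → trace x ω = T)) ∧
  ∀ (α : Type) (x y : Fin N → α),
    (PMF.uniformOfFintype (Coins p)).map (trace x) = (PMF.uniformOfFintype (Coins p)).map (trace y)

/-- Distribution of the output on input `x`; a failing run outputs the symbol `none`. -/
noncomputable def outputLaw (p : Params) {N : ℕ} (x : Fin N → Fin N) :
    PMF (Option (Fin N → Option (Fin N))) :=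
  (PMF.uniformOfFintype (Coins p)).map (output x)

/-- The uniform distribution on the permutations (arrangements) of the `N` items. -/
noncomputable def uniformLaw (N : ℕ) : PMF (Option (Fin N → Option (Fin N))) :=
  (PMF.uniformOfFintype (Equiv.Perm (Fin N))).map fun π => some fun i => some (π i)

/-- Statistical (total variation) distance. -/
noncomputable def statDist {Ω : Type} [Fintype Ω] (P Q : PMF Ω) : ℝ :=
  (1 / 2) * ∑ a, |(P a).toReal - (Q a).toReal|

/-- The instance for `N` items with exponent `ε`. -/
noncomputable def params (N : ℕ) (ε : ℝ) : Params where
  B := ⌈(N : ℝ) ^ (1 / 2 - ε)⌉₊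
  D := ⌈(N : ℝ) / ⌈(N : ℝ) ^ (1 / 2 - ε)⌉₊⌉₊
  C := ⌈(1 + ε) * (N : ℝ) ^ (2 * ε)⌉₊
  S := ⌈(N : ℝ) ^ (1 / 2 + 2 * ε)⌉₊
  K := ⌈(N : ℝ) ^ (3 * ε)⌉₊
  W := 2
  Q := ⌈(N : ℝ) ^ (1 / 2 + ε)⌉₊

/-- `ln ln N / ln N ≪ ε ≪ 1`, with `ε` positive. -/
def Admissible (ε : ℕ → ℝ) : Prop :=
  (∀ᶠ N in atTop, 0 < ε N) ∧ Tendsto ε atTop (𝓝 0) ∧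
    (fun N : ℕ => Real.log (Real.log N) / Real.log N) =o[atTop] ε

end StashShuffle

/-! Obliviousness is parametricity together with straight-line control flow. No procedure inspects
an item, so the run on input `x` is the run on the identity input relabelled by `x`
(`sim_stashShuffle`); for fixed coins the accesses therefore do not depend on the input at all. Each
loop makes accesses that are fixed in advance and can only be cut short by a failure
(`hasTrace_stashShuffle`). The memory bound is a loop invariant that also has to survive failing
runs (`memInv_stashShuffle`).

For uniformity, call the targets of the items good (`Good`) if two families of counting inequalities
hold. First, for every output bucket `j`, any run of consecutive input buckets sends at most `C`
items per bucket plus an excess `κ` to `j`. The part of the stash belonging to `j` behaves like a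
queue served at rate `C`; tracing it back to a time when it was empty bounds it by `κ`, and since `B
* κ < S` and `κ ≤ K` neither the stash nor its final drain fails. Second, the number of items with
target below `b` stays within the slack of the compression queue. On good targets the run succeeds,
whatever the permutations, and outputs the concatenation of the permuted buckets (`output_of_good`).

Conditioning on good targets destroys uniformity of the targets, so an exact law is not computed. It
suffices that every arrangement `π` satisfies P(good and output `π`) ≤ 1/N! (`card_good_output_le`):
summing excesses then bounds the statistical distance by P(bad) (`statDist_outputLaw_le`). For this
bound, fix targets `v`. Output `π` forces `v` to be monotone along `π`, and then forces the order of
each bucket, which has probability at most ∏ 1/c_j! with c_j the bucket loads. A monotone map is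
determined by its fibre sizes, so averaging over `v` gives at most B^(-N) ∑ ∏ 1/c_j! ≤ 1/N! by the
multinomial theorem (`sum_monotone_inv_factorial_le`).

Finally P(bad) is a union of Chernoff bounds (`card_count_ge_le`, `card_bad_le`). With X = N^ε each
event has probability at most exp(-X²/64), and the lower bound on ε gives X ≥ ln N, so the total is
at most N^(4 - ln N / 64). -/

namespace StashShuffle

/-! ### Semantics of runs, relabelling of items, and obliviousness -/

section Semantics

variable {p : Params} {N : ℕ} {α α' β β' γ γ' : Type}

/-- Result and final state of a procedure started in state `s`. -/
def exec (x : Proc p N α β) (s : State p N α) : Option β × State p N α := x.run.run s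

@[simp] theorem exec_pure (a : β) (s : State p N α) :
    exec (pure a : Proc p N α β) s = (some a, s) := rfl

@[simp] theorem exec_failure (s : State p N α) :
    exec (failure : Proc p N α β) s = (none, s) := rfl

theorem exec_bind (x : Proc p N α β) (k : β → Proc p N α γ) (s : State p N α) :
    exec (x >>= k) s =
      match exec x s with
      | (some a, s') => exec (k a) s'
      | (none, s') => (none, s') := by
  have e : exec (x >>= k) s = (match exec x s with
      | (o, s') => (match o with
        | some a => (k a).run
        | none => Pure.pure none : StateM (State p N α) (Option γ)).run s') := rfl
  rw [e]
  rcases exec x s with ⟨_ | a, s'⟩ <;> rfl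

theorem exec_bind_some {x : Proc p N α β} {k : β → Proc p N α γ} {s s' : State p N α} {a : β}
    (h : exec x s = (some a, s')) : exec (x >>= k) s = exec (k a) s' := by
  rw [exec_bind, h]

theorem exec_bind_none {x : Proc p N α β} {k : β → Proc p N α γ} {s s' : State p N α}
    (h : exec x s = (none, s')) : exec (x >>= k) s = (none, s') := by
  rw [exec_bind, h]

@[simp] theorem exec_privately (f : Private p α → Private p α) (s : State p N α) :
    exec (privately f) s =
      (some (), { s with priv := f s.priv, peak := max s.peak (f s.priv).words }) := rfl

@[simp] theorem exec_getPrivate (s : State p N α) :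
    exec (getPrivate : Proc p N α _) s = (some s.priv, s) := rfl

@[simp] theorem exec_writeMid (j : Fin p.B) (i : ℕ) (x : Option α) (s : State p N α) :
    exec (writeMid j i x) s = (some (), { s with
      mid := Function.update s.mid j (Function.update (s.mid j) i x)
      trace := s.trace ++ [Access.writeMid j i] }) := rfl

@[simp] theorem exec_writeOut (i : Fin N) (a : α) (s : State p N α) :
    exec (writeOut i a) s = (some (), { s with
      out := Function.update s.out i (some a)
      trace := s.trace ++ [Access.writeOut i] }) := rfl

theorem forM_cons (b : β) (l : List β) (f : β → Proc p N α Unit) :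
    (b :: l).forM f = f b >>= fun _ => l.forM f := rfl

/-! Relabelling the items. -/

/-- Relabel the items in the private memory. -/
def Private.map (f : α → α') (m : Private p α) : Private p α' where
  stash j := (m.stash j).map f
  chunk j := (m.chunk j).map (Option.map f)
  targets := m.targets
  bucket := m.bucket.map (Option.map f)
  queue := m.queue.map f

@[simp] theorem Private.map_stashSize (f : α → α') (m : Private p α) :
    (m.map f).stashSize = m.stashSize := by
  simp [Private.stashSize, Private.map]

@[simp] theorem Private.map_words (f : α → α') (m : Private p α) :
    (m.map f).words = m.words := by
  simp [Private.words, Private.map]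

/-- Relabel the items in a state. -/
def State.map (f : α → α') (s : State p N α) : State p N α' where
  inp i := f (s.inp i)
  mid j i := (s.mid j i).map f
  out i := (s.out i).map f
  trace := s.trace
  priv := s.priv.map f
  peak := s.peak

/-- `y` does on relabelled data what `x` does on the original data. -/
def Sim (f : α → α') (g : β → β') (x : Proc p N α β) (y : Proc p N α' β') : Prop :=
  ∀ s, exec y (s.map f) = ((exec x s).1.map g, (exec x s).2.map f)

variable {f : α → α'} {g : β → β'} {h : γ → γ'}

theorem Sim.pure (a : β) : Sim f g (pure a : Proc p N α β) (pure (g a)) := fun _ => rfl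

theorem Sim.failure : Sim f g (failure : Proc p N α β) failure := fun _ => rfl

theorem Sim.bind {x : Proc p N α β} {y : Proc p N α' β'} {k : β → Proc p N α γ}
    {k' : β' → Proc p N α' γ'} (hx : Sim f g x y) (hk : ∀ a, Sim f h (k a) (k' (g a))) :
    Sim f h (x >>= k) (y >>= k') := by
  intro s
  have := hx s
  rcases e : exec x s with ⟨_ | a, s'⟩ <;> rw [e] at this
  · rw [exec_bind_none e, exec_bind_none this]; rfl
  · rw [exec_bind_some e, exec_bind_some this]; exact hk a s'

theorem Sim.getPrivate : Sim f (Private.map f) (getPrivate : Proc p N α _) getPrivate :=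
  fun _ => rfl

theorem Sim.privately {t : Private p α → Private p α} {t' : Private p α' → Private p α'}
    (ht : ∀ m, (t m).map f = t' (m.map f)) :
    Sim f id (privately t : Proc p N α _) (privately t') := by
  intro s
  simp [State.map, ← ht]

theorem Sim.readIn (i : Fin N) : Sim f f (readIn i : Proc p N α _) (readIn i) := fun _ => rfl

theorem Sim.readMid (j : Fin p.B) (i : ℕ) :
    Sim f (Option.map f) (readMid j i : Proc p N α _) (readMid j i) := fun _ => rfl

theorem Sim.writeMid (j : Fin p.B) (i : ℕ) (x : Option α) :
    Sim f id (writeMid j i x : Proc p N α _) (writeMid j i (x.map f)) := by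
  intro s
  simp only [exec_writeMid, State.map, Option.map_some, Prod.mk.injEq, State.mk.injEq, true_and,
    and_true, id]
  funext j' i'
  by_cases hj : j' = j
  · subst hj
    by_cases hi : i' = i
    · subst hi; simp
    · simp [hi]
  · simp [hj]

theorem Sim.writeOut (i : Fin N) (a : α) :
    Sim f id (writeOut i a : Proc p N α _) (writeOut i (f a)) := by
  intro s
  simp only [exec_writeOut, State.map, Option.map_some, Prod.mk.injEq, State.mk.injEq, true_and,
    and_true, id]
  funext i'
  by_cases hi : i' = i
  · subst hi; simp
  · simp [hi]

theorem Sim.forM {g : β → β'} {k : β → Proc p N α Unit} {k' : β' → Proc p N α' Unit}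
    (hk : ∀ a, Sim f id (k a) (k' (g a))) (l : List β) :
    Sim f id (l.forM k) ((l.map g).forM k') := by
  induction l with
  | nil => exact Sim.pure (g := id) ()
  | cons a l ih => exact Sim.bind (hk a) fun _ => ih

theorem Sim.forM_id {k : β → Proc p N α Unit} {k' : β → Proc p N α' Unit} (l : List β)
    (hk : ∀ a, Sim f id (k a) (k' a)) : Sim f id (l.forM k) (l.forM k') := by
  simpa using Sim.forM (g := id) hk l

theorem sim_unstash (cap : ℕ) : Sim f id (unstash cap : Proc p N α _) (unstash cap) := by
  apply Sim.privately
  intro m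
  simp [Private.map, List.map_take, List.map_drop]

theorem sim_place (i : ℕ) (a : α) : Sim f id (place i a : Proc p N α _) (place i (f a)) := by
  unfold place
  refine Sim.bind Sim.getPrivate fun m => ?_
  have e : (m.map f).targets = m.targets := rfl
  rw [e]
  cases m.targets[i]? with
  | none => exact Sim.failure
  | some t =>
    simp only [Private.map_stashSize]
    have e : ((m.map f).chunk t).length = (m.chunk t).length := by simp [Private.map]
    rw [e]
    split_ifs
    · apply Sim.privately
      intro m
      simp only [Private.map, Private.mk.injEq, and_true, true_and]
      funext j
      by_cases hj : j = t
      · subst hj; simp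
      · simp [hj]
    · apply Sim.privately
      intro m
      simp only [Private.map, Private.mk.injEq, and_true]
      funext j
      by_cases hj : j = t
      · subst hj; simp
      · simp [hj]
    · exact Sim.failure

theorem sim_flush (cap off : ℕ) : Sim f id (flush cap off : Proc p N α _) (flush cap off) := by
  unfold flush
  refine Sim.bind (g := id) (Sim.privately fun m => ?_) fun _ => ?_
  · simp [Private.map]
  refine Sim.bind (g := id) (Sim.forM_id _ fun j => Sim.forM_id _ fun i =>
    Sim.bind Sim.getPrivate fun m => ?_) fun _ => Sim.privately fun m => ?_
  · have e : ((m.map f).chunk j).getD i none = ((m.chunk j).getD i none).map f := by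
      simp only [Private.map, List.getD_eq_getElem?_getD, List.getElem?_map]
      cases (m.chunk j)[i]? <;> rfl
    rw [e]
    exact Sim.writeMid _ _ _
  · simp [Private.map]

theorem sim_distributeBucket (ω : Coins p) (b : Fin p.B) :
    Sim f id (distributeBucket ω b : Proc p N α _) (distributeBucket ω b) := by
  unfold distributeBucket
  refine Sim.bind (g := id) (Sim.privately fun m => rfl) fun _ => ?_
  refine Sim.bind (g := id) (sim_unstash _) fun _ => ?_
  refine Sim.bind (g := id) (Sim.forM_id _ fun i => ?_) fun _ => sim_flush _ _
  split_ifs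
  · exact Sim.bind (Sim.readIn _) fun a => sim_place _ _
  · exact Sim.pure (g := id) ()

theorem sim_enqueue (a : α) : Sim f id (enqueue a : Proc p N α _) (enqueue (f a)) := by
  unfold enqueue
  refine Sim.bind Sim.getPrivate fun m => ?_
  have e : (m.map f).queue.length = m.queue.length := by simp [Private.map]
  rw [e]
  split_ifs
  · exact Sim.privately fun m => by simp [Private.map]
  · exact Sim.failure

theorem sim_dequeue : Sim f f (dequeue : Proc p N α _) dequeue := by
  unfold dequeue
  refine Sim.bind Sim.getPrivate fun m => ?_
  have e : (m.map f).queue = m.queue.map f := rfl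
  rw [e]
  cases m.queue with
  | nil => exact Sim.failure
  | cons a q => exact Sim.bind (g := id) (Sim.privately fun m => rfl) fun _ => Sim.pure (g := f) a

theorem sim_importIntermediate (ω : Coins p) (b : Fin p.B) :
    Sim f id (importIntermediate ω b : Proc p N α _) (importIntermediate ω b) := by
  unfold importIntermediate
  refine Sim.bind (g := id) (Sim.forM_id _ fun i => Sim.bind (Sim.readMid _ _) fun x =>
    Sim.privately fun m => by simp [Private.map]) fun _ => ?_
  refine Sim.bind (g := id) (Sim.privately fun m => ?_) fun _ => ?_
  · simp only [Private.map, Private.mk.injEq, and_true, true_and, List.map_ofFn]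
    congr 1
    funext i
    simp only [List.getD_eq_getElem?_getD, List.getElem?_map, Function.comp]
    cases m.bucket[(ω.perms b i : ℕ)]? <;> rfl
  refine Sim.bind Sim.getPrivate fun m => ?_
  refine Sim.bind (g := id) (Sim.forM (g := Option.map f) (fun x => ?_) m.bucket) fun _ =>
    Sim.privately fun m => rfl
  cases x with
  | none => exact Sim.pure (g := id) ()
  | some a => exact sim_enqueue a

theorem sim_drainQueue (b : ℕ) : Sim f id (drainQueue b : Proc p N α _) (drainQueue b) := by
  unfold drainQueue
  refine Sim.forM_id _ fun i => ?_
  split_ifs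
  · exact Sim.bind sim_dequeue fun a => Sim.writeOut _ _
  · exact Sim.pure (g := id) ()

theorem sim_compress (ω : Coins p) : Sim f id (compress ω : Proc p N α _) (compress ω) := by
  unfold compress
  refine Sim.bind (g := id) (Sim.forM_id _ fun i => sim_importIntermediate _ _) fun _ => ?_
  refine Sim.bind (g := id) (Sim.forM_id _ fun i =>
    Sim.bind (g := id) (sim_drainQueue _) fun _ => sim_importIntermediate _ _) fun _ => ?_
  exact Sim.forM_id _ fun i => sim_drainQueue _

theorem sim_stashShuffle (ω : Coins p) :
    Sim f id (stashShuffle ω : Proc p N α _) (stashShuffle ω) := by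
  unfold stashShuffle
  refine Sim.bind (g := id) (Sim.forM_id _ fun i => sim_distributeBucket _ _) fun _ => ?_
  refine Sim.bind (g := id) (Sim.bind (g := id) (sim_unstash _) fun _ => sim_flush _ _) fun _ => ?_
  refine Sim.bind Sim.getPrivate fun m => ?_
  rw [Private.map_stashSize]
  split_ifs
  · exact sim_compress _
  · exact Sim.failure

theorem initialState_map (x : Fin N → α) (f : α → α') :
    (initialState p x).map f = initialState p (f ∘ x) := by
  unfold initialState State.map
  simp only [State.mk.injEq, Option.map_none, Function.comp_def, true_and]
  have : (Private.empty p α).map f = Private.empty p α' := rfl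
  exact ⟨this, by rw [← this, Private.map_words]⟩

/-- The accesses do not depend on the items. -/
theorem trace_eq_trace_id (x : Fin N → α) (ω : Coins p) :
    trace x ω = trace (id : Fin N → Fin N) ω := by
  -- Any input is the image under itself of the input whose items are their own positions.
  have := sim_stashShuffle (f := x) ω (initialState p id)
  rw [initialState_map, Function.comp_id] at this
  exact congrArg (fun r => r.2.trace) this

/-! The accesses of a successful run. -/

/-- A successful run of `x` makes the accesses `T`, a failing one an initial segment of `T`. -/
def HasTrace (x : Proc p N α β) (T : List Access) : Prop :=
  ∀ s, ∃ T', T' <+: T ∧ (exec x s).2.trace = s.trace ++ T' ∧ ((exec x s).1.isSome → T' = T)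

theorem HasTrace.pure (a : β) : HasTrace (pure a : Proc p N α β) [] :=
  fun s => ⟨[], by simp⟩

theorem HasTrace.failure (T : List Access) : HasTrace (failure : Proc p N α β) T :=
  fun s => ⟨[], by simp⟩

/-- The accesses `U` of the continuation must be the same for every value passed to it; this is
where data-independence of the addresses enters. If the first part fails, its initial segment of `T`
is also one of `T ++ U`. -/
theorem HasTrace.bind {x : Proc p N α β} {k : β → Proc p N α γ} {T U : List Access}
    (hx : HasTrace x T) (hk : ∀ a, HasTrace (k a) U) : HasTrace (x >>= k) (T ++ U) := by
  intro s
  obtain ⟨T', h1, h2, h3⟩ := hx s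
  rcases e : exec x s with ⟨_ | a, s'⟩ <;> rw [e] at h2 h3
  · rw [exec_bind_none e]
    exact ⟨T', h1.trans (List.prefix_append _ _), h2, by simp⟩
  · rw [exec_bind_some e]
    obtain ⟨U', g1, g2, g3⟩ := hk a s'
    obtain rfl := h3 rfl
    refine ⟨T' ++ U', (List.prefix_append_right_inj _).2 g1, ?_, fun h => by rw [g3 h]⟩
    rw [g2, h2, List.append_assoc]

theorem HasTrace.bind_nil_right {x : Proc p N α β} {k : β → Proc p N α γ} {T : List Access}
    (hx : HasTrace x T) (hk : ∀ a, HasTrace (k a) []) : HasTrace (x >>= k) T := by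
  simpa using hx.bind hk

theorem HasTrace.bind_nil_left {x : Proc p N α β} {k : β → Proc p N α γ} {T : List Access}
    (hx : HasTrace x []) (hk : ∀ a, HasTrace (k a) T) : HasTrace (x >>= k) T := by
  simpa using hx.bind hk

theorem HasTrace.getPrivate : HasTrace (getPrivate : Proc p N α _) [] := fun s => ⟨[], by simp⟩

theorem HasTrace.privately (f : Private p α → Private p α) :
    HasTrace (privately f : Proc p N α _) [] := fun s => ⟨[], by simp⟩

theorem HasTrace.forM {k : β → Proc p N α Unit} {T : β → List Access} (l : List β)
    (hk : ∀ a, HasTrace (k a) (T a)) : HasTrace (l.forM k) (l.flatMap T) := by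
  induction l with
  | nil => exact HasTrace.pure ()
  | cons a l ih =>
    rw [List.flatMap_cons]
    exact (hk a).bind fun _ => ih

theorem HasTrace.forM_nil {k : β → Proc p N α Unit} (l : List β)
    (hk : ∀ a, HasTrace (k a) []) : HasTrace (l.forM k) [] := by
  have := HasTrace.forM (T := fun _ => []) l hk
  rwa [List.flatMap_eq_nil_iff.2 fun _ _ => rfl] at this

theorem hasTrace_place (i : ℕ) (a : α) : HasTrace (place i a : Proc p N α _) [] := by
  unfold place
  refine HasTrace.getPrivate.bind_nil_left fun m => ?_
  cases m.targets[i]? with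
  | none => exact HasTrace.failure _
  | some t =>
    dsimp only
    split_ifs
    · exact HasTrace.privately _
    · exact HasTrace.privately _
    · exact HasTrace.failure _

/-- The accesses of `flush`. -/
def flushTrace (p : Params) (cap off : ℕ) : List Access :=
  (List.finRange p.B).flatMap fun j : Fin p.B =>
    (List.range cap).flatMap fun i => [Access.writeMid j (off + i)]

theorem hasTrace_flush (cap off : ℕ) :
    HasTrace (flush cap off : Proc p N α _) (flushTrace p cap off) := by
  unfold flush flushTrace
  refine (HasTrace.privately _).bind_nil_left fun _ => ?_
  refine HasTrace.bind_nil_right ?_ fun _ => HasTrace.privately _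
  refine HasTrace.forM _ fun j => ?_
  refine HasTrace.forM (T := fun i => [Access.writeMid j (off + i)]) _ fun i => ?_
  exact HasTrace.getPrivate.bind_nil_left fun m s => ⟨_, List.prefix_refl _, rfl, fun _ => rfl⟩

/-- The accesses of `distributeBucket`. -/
def distributeTrace (p : Params) (N : ℕ) (b : Fin p.B) : List Access :=
  ((List.range p.D).flatMap fun i =>
    if b * p.D + i < N then [Access.readIn (b * p.D + i)] else []) ++ flushTrace p p.C (b * p.C)

theorem hasTrace_distributeBucket (ω : Coins p) (b : Fin p.B) :
    HasTrace (distributeBucket ω b : Proc p N α _) (distributeTrace p N b) := by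
  unfold distributeBucket
  refine (HasTrace.privately _).bind_nil_left fun _ => ?_
  refine (HasTrace.privately _).bind_nil_left fun _ => ?_
  refine HasTrace.bind (HasTrace.forM _ fun i => ?_) fun _ => hasTrace_flush _ _
  split_ifs
  · exact HasTrace.bind_nil_right (fun s => ⟨_, List.prefix_refl _, rfl, fun _ => rfl⟩)
      fun a => hasTrace_place _ _
  · exact HasTrace.pure _

/-- The accesses of `importIntermediate`. -/
def importTrace (p : Params) (b : Fin p.B) : List Access :=
  (List.range p.midSize).flatMap fun i => [Access.readMid b i]

theorem hasTrace_importIntermediate (ω : Coins p) (b : Fin p.B) :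
    HasTrace (importIntermediate ω b : Proc p N α _) (importTrace p b) := by
  unfold importIntermediate
  refine HasTrace.bind_nil_right (HasTrace.forM _ fun i => ?_) fun _ => ?_
  · exact HasTrace.bind_nil_right (fun s => ⟨_, List.prefix_refl _, rfl, fun _ => rfl⟩)
      fun a => HasTrace.privately _
  refine (HasTrace.privately _).bind_nil_left fun _ => ?_
  refine HasTrace.getPrivate.bind_nil_left fun m => ?_
  refine HasTrace.bind_nil_right (HasTrace.forM_nil _ fun x => ?_) fun _ => HasTrace.privately _
  cases x with
  | none => exact HasTrace.pure ()
  | some a =>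
    refine HasTrace.getPrivate.bind_nil_left fun m => ?_
    split_ifs
    · exact HasTrace.privately _
    · exact HasTrace.failure _

/-- The accesses of `drainQueue`. -/
def drainTrace (p : Params) (N b : ℕ) : List Access :=
  (List.range p.D).flatMap fun i =>
    if b * p.D + i < N then [Access.writeOut (b * p.D + i)] else []

theorem hasTrace_drainQueue (b : ℕ) :
    HasTrace (drainQueue b : Proc p N α _) (drainTrace p N b) := by
  unfold drainQueue
  refine HasTrace.forM _ fun i => ?_
  split_ifs
  · refine HasTrace.bind_nil_left ?_ fun a s => ⟨_, List.prefix_refl _, rfl, fun _ => rfl⟩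
    refine HasTrace.getPrivate.bind_nil_left fun m => ?_
    cases m.queue with
    | nil => exact HasTrace.failure _
    | cons a q => exact (HasTrace.privately _).bind_nil_left fun _ => HasTrace.pure _
  · exact HasTrace.pure _

/-- The accesses of `compress`. -/
def compressTrace (p : Params) (N : ℕ) : List Access :=
  ((List.finRange p.B).take (min p.W p.B)).flatMap (importTrace p) ++
    (((List.finRange p.B).drop (min p.W p.B)).flatMap (fun b : Fin p.B =>
      drainTrace p N (b - min p.W p.B) ++ importTrace p b) ++
    ((List.finRange p.B).drop (p.B - min p.W p.B)).flatMap (fun b : Fin p.B => drainTrace p N b))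

theorem hasTrace_compress (ω : Coins p) :
    HasTrace (compress ω : Proc p N α _) (compressTrace p N) := by
  unfold compress
  refine HasTrace.bind ?_ fun _ => HasTrace.bind ?_ fun _ => ?_
  · exact HasTrace.forM _ fun b => hasTrace_importIntermediate _ _
  · refine HasTrace.forM _ fun b => ?_
    exact (hasTrace_drainQueue _).bind fun _ => hasTrace_importIntermediate _ _
  · refine HasTrace.forM _ fun b => ?_
    exact hasTrace_drainQueue _

/-- The accesses of a successful run. -/
def fullTrace (p : Params) (N : ℕ) : List Access :=
  (List.finRange p.B).flatMap (distributeTrace p N) ++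
    (flushTrace p p.K (p.C * p.B) ++ compressTrace p N)

theorem hasTrace_stashShuffle (ω : Coins p) :
    HasTrace (stashShuffle ω : Proc p N α _) (fullTrace p N) := by
  unfold stashShuffle
  refine HasTrace.bind ?_ fun _ => HasTrace.bind ?_ fun _ => ?_
  · exact HasTrace.forM _ fun b => hasTrace_distributeBucket _ _
  · exact (HasTrace.privately _).bind_nil_left fun _ => hasTrace_flush _ _
  refine HasTrace.bind_nil_left HasTrace.getPrivate fun m => ?_
  split_ifs
  · exact hasTrace_compress _
  · exact HasTrace.failure _

theorem oblivious (p : Params) (N : ℕ) : Oblivious p N := by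
  constructor
  · refine ⟨fullTrace p N, fun α x ω => ?_⟩
    obtain ⟨T', h1, h2, h3⟩ := hasTrace_stashShuffle ω (initialState p x)
    have h2' : trace x ω = T' := h2
    refine ⟨h2' ▸ h1, fun h => h2'.trans (h3 ?_)⟩
    rw [output, Option.isSome_map] at h
    exact h
  · intro α x y
    -- The two traces agree coin by coin, which is stronger than equality in law.
    congr 1
    funext ω
    rw [trace_eq_trace_id x, trace_eq_trace_id y]

end Semantics

/-! ### Private memory: upper bound on every run, lower bound by the list lengths -/

section Memory

variable {p : Params} {N : ℕ} {α β γ : Type}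

/-- Partial correctness with a postcondition `E` for failing runs. -/
def Triple (P : State p N α → Prop) (x : Proc p N α β) (Q : β → State p N α → Prop)
    (E : State p N α → Prop) : Prop :=
  ∀ s, P s → (∀ a s', exec x s = (some a, s') → Q a s') ∧ (∀ s', exec x s = (none, s') → E s')

variable {P : State p N α → Prop} {E : State p N α → Prop}

theorem Triple.intro {x : Proc p N α β} {Q : β → State p N α → Prop}
    (h : ∀ s, P s → ∃ a s', exec x s = (some a, s') ∧ Q a s') :
    Triple P x Q E := by
  intro s hs
  obtain ⟨a, s', h1, h2⟩ := h s hs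
  rw [h1]
  refine ⟨fun b t e => ?_, fun t e => ?_⟩
  · simp only [Prod.mk.injEq, Option.some.injEq] at e
    rw [← e.1, ← e.2]; exact h2
  · simp at e

theorem Triple.bind {x : Proc p N α β} {k : β → Proc p N α γ} {Q : β → State p N α → Prop}
    {R : γ → State p N α → Prop} (hx : Triple P x Q E) (hk : ∀ a, Triple (Q a) (k a) R E) :
    Triple P (x >>= k) R E := by
  intro s hs
  obtain ⟨h1, h2⟩ := hx s hs
  rcases e : exec x s with ⟨_ | a, s'⟩
  · rw [exec_bind_none e]
    refine ⟨fun a t e' => by simp at e', fun t e' => ?_⟩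
    simp only [Prod.mk.injEq, true_and] at e'
    rw [← e']
    exact h2 _ e
  · rw [exec_bind_some e]
    exact hk a s' (h1 _ _ e)

theorem Triple.conseq {x : Proc p N α β} {P' : State p N α → Prop}
    {Q Q' : β → State p N α → Prop} (h : Triple P x Q E) (hP : ∀ s, P' s → P s)
    (hQ : ∀ a s, Q a s → Q' a s) : Triple P' x Q' E :=
  fun s hs => ⟨fun a s' e => hQ a s' ((h s (hP s hs)).1 a s' e), (h s (hP s hs)).2⟩

theorem Triple.pure (a : β) : Triple P (pure a : Proc p N α β) (fun b s => b = a ∧ P s) E :=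
  Triple.intro fun _ hs => ⟨a, _, rfl, rfl, hs⟩

theorem Triple.failure {Q : β → State p N α → Prop} (h : ∀ s, P s → E s) :
    Triple P (failure : Proc p N α β) Q E := by
  intro s hs
  refine ⟨fun a s' e => by simp at e, fun s' e => ?_⟩
  simp only [exec_failure, Prod.mk.injEq, true_and] at e
  exact e ▸ h s hs

theorem Triple.getPrivate :
    Triple P (getPrivate : Proc p N α _) (fun m s => m = s.priv ∧ P s) E :=
  Triple.intro fun _ hs => ⟨_, _, rfl, rfl, hs⟩

theorem Triple.forM {l : List β} {k : β → Proc p N α Unit} (I : ℕ → State p N α → Prop)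
    (h : ∀ i (hi : i < l.length), Triple (I i) (k l[i]) (fun _ => I (i + 1)) E) :
    Triple (I 0) (l.forM k) (fun _ => I l.length) E := by
  induction l generalizing I with
  | nil => exact (Triple.pure ()).conseq (fun _ h => h) fun _ _ h => h.2
  | cons a l ih =>
    rw [forM_cons]
    refine Triple.bind (h 0 (by simp)) fun _ => ?_
    refine ih (fun i => I (i + 1)) fun i hi => ?_
    exact h (i + 1) (by simpa using hi)

theorem Triple.forM_const {l : List β} {k : β → Proc p N α Unit}
    (h : ∀ a, Triple P (k a) (fun _ => P) E) : Triple P (l.forM k) (fun _ => P) E :=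
  Triple.forM (fun _ => P) fun _ _ => h _

theorem Triple.forM_range {n : ℕ} {k : ℕ → Proc p N α Unit} (I : ℕ → State p N α → Prop)
    (h : ∀ i < n, Triple (I i) (k i) (fun _ => I (i + 1)) E) :
    Triple (I 0) ((List.range n).forM k) (fun _ => I n) E := by
  have := Triple.forM (l := List.range n) (k := k) (E := E) I fun i hi => by
    rw [List.getElem_range]
    exact h i (by simpa using hi)
  rwa [List.length_range] at this

theorem stashSize_update (s : Fin p.B → List α) (t : Fin p.B) (a : α) :
    ∑ j, (Function.update s t (s t ++ [a]) j).length = ∑ j, (s j).length + 1 := by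
  rw [← Finset.add_sum_erase _ _ (Finset.mem_univ t),
    ← Finset.add_sum_erase (a := t) _ (fun j => (s j).length) (Finset.mem_univ t)]
  rw [Finset.sum_congr rfl fun j hj => by
    rw [Function.update_of_ne (Finset.ne_of_mem_erase hj)]]
  simp
  omega

/-- Bound for the private memory in use. -/
def memBound (p : Params) : ℕ :=
  (p.S + p.B) + p.B * (p.C + p.K + 1) + (p.D + 1) + (p.midSize + 1) + (p.W * p.D + p.Q + 1) + 4

/-- Bounds for the parts of the private memory, with a loaded intermediate bucket of length `k`. -/
structure MemInv (k : ℕ) (s : State p N α) : Prop where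
  stash : s.priv.stashSize ≤ p.S
  chunk : ∀ j, (s.priv.chunk j).length ≤ p.C + p.K
  targets : s.priv.targets.length ≤ p.D
  bucket : s.priv.bucket.length = k
  queue : s.priv.queue.length ≤ p.W * p.D + p.Q
  peak : p.B ≤ s.peak ∧ s.peak ≤ memBound p

theorem words_le {m : Private p α} (h1 : m.stashSize ≤ p.S)
    (h2 : ∀ j, (m.chunk j).length ≤ p.C + p.K) (h3 : m.targets.length ≤ p.D)
    (h4 : m.bucket.length ≤ p.midSize) (h5 : m.queue.length ≤ p.W * p.D + p.Q) :
    m.words ≤ memBound p := by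
  unfold Private.words memBound
  have e1 : ∑ j, ((m.stash j).length + 1) = m.stashSize + p.B := by
    simp [Finset.sum_add_distrib, Private.stashSize]
  have e2 : ∑ j, ((m.chunk j).length + 1) ≤ p.B * (p.C + p.K + 1) := by
    refine (Finset.sum_le_card_nsmul _ _ (p.C + p.K + 1) fun j _ => by
      have := h2 j; omega).trans ?_
    simp
  omega

/-- The error postcondition: bounds for the memory used. -/
abbrev PeakLe (s : State p N α) : Prop := p.B ≤ s.peak ∧ s.peak ≤ memBound p

/-- `privately` is the only primitive that moves the peak, so all memory reasoning reduces to size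
bounds on the private memory after one such step. -/
theorem memInv_privately {P : State p N α → Prop} (k : ℕ) (f : Private p α → Private p α)
    (hk : k ≤ p.midSize)
    (h : ∀ s, P s → (p.B ≤ s.peak ∧ s.peak ≤ memBound p) ∧ (f s.priv).stashSize ≤ p.S ∧
      (∀ j, ((f s.priv).chunk j).length ≤ p.C + p.K) ∧ (f s.priv).targets.length ≤ p.D ∧
      (f s.priv).bucket.length = k ∧ (f s.priv).queue.length ≤ p.W * p.D + p.Q) :
    Triple P (privately f) (fun _ => MemInv k) PeakLe := by
  refine Triple.intro fun s hs => ⟨(), _, rfl, ?_⟩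
  obtain ⟨h0, h1, h2, h3, h4, h5⟩ := h s hs
  exact ⟨h1, h2, h3, h4, h5, le_max_of_le_left h0.1,
    max_le h0.2 (words_le h1 h2 h3 (h4.le.trans hk) h5)⟩

theorem memInv_unstash {k cap : ℕ} (hk : k ≤ p.midSize) (hc : cap ≤ p.C + p.K) :
    Triple (MemInv k) (unstash cap : Proc p N α _) (fun _ => MemInv k) PeakLe := by
  refine memInv_privately k _ hk fun s hs => ⟨hs.peak, ?_, fun j => ?_, hs.targets, hs.bucket,
    hs.queue⟩
  · refine le_trans (Finset.sum_le_sum fun j _ => ?_) hs.stash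
    simp
  · simp only [List.length_map, List.length_take]
    omega

theorem memInv_place {k : ℕ} (hk : k ≤ p.midSize) (i : ℕ) (a : α) :
    Triple (MemInv k) (place i a : Proc p N α _) (fun _ => MemInv k) PeakLe := by
  unfold place
  refine Triple.bind Triple.getPrivate fun m => ?_
  cases m.targets[i]? with
  | none => exact Triple.failure fun s hs => hs.2.peak
  | some t =>
    dsimp only
    split_ifs with h1 h2
    · refine memInv_privately k _ hk fun s hs => ?_
      obtain ⟨rfl, hs⟩ := hs
      refine ⟨hs.peak, hs.stash, fun j => ?_, hs.targets, hs.bucket, hs.queue⟩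
      by_cases hj : j = t
      · subst hj; simp; omega
      · simpa [hj] using hs.chunk j
    · refine memInv_privately k _ hk fun s hs => ?_
      obtain ⟨rfl, hs⟩ := hs
      refine ⟨hs.peak, ?_, hs.chunk, hs.targets, hs.bucket, hs.queue⟩
      rw [Private.stashSize, stashSize_update]
      exact h2
    · exact Triple.failure fun s hs => hs.2.peak

/-- Padding brings a chunk to the maximum of its length and `cap`. The common bound `C + K` covers
both uses, with capacity `C` during distribution and `K` for the stash drain. -/
theorem memInv_flush {k cap : ℕ} (hk : k ≤ p.midSize) (hc : cap ≤ p.C + p.K) (off : ℕ) :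
    Triple (MemInv k) (flush cap off : Proc p N α _) (fun _ => MemInv k) PeakLe := by
  unfold flush
  refine Triple.bind (Q := fun _ => MemInv k) (memInv_privately k _ hk fun s hs =>
    ⟨hs.peak, hs.stash, fun j => ?_, by simp, hs.bucket, hs.queue⟩) fun _ => ?_
  · have := hs.chunk j
    simp only [List.length_append, List.length_replicate]
    omega
  refine Triple.bind (Q := fun _ => MemInv k) (Triple.forM_const fun j => Triple.forM_const fun i =>
    Triple.bind Triple.getPrivate fun m => Triple.intro fun s hs => ⟨(), _, rfl, ?_⟩) fun _ => ?_
  · obtain ⟨-, hs⟩ := hs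
    exact ⟨hs.stash, hs.chunk, hs.targets, hs.bucket, hs.queue, hs.peak⟩
  · exact memInv_privately k _ hk fun s hs =>
      ⟨hs.peak, hs.stash, fun j => by simp, hs.targets, hs.bucket, hs.queue⟩

theorem memInv_distributeBucket (ω : Coins p) (b : Fin p.B) :
    Triple (MemInv 0) (distributeBucket ω b : Proc p N α _) (fun _ => MemInv 0) PeakLe := by
  unfold distributeBucket
  refine Triple.bind (Q := fun _ => MemInv 0) (memInv_privately 0 _ (Nat.zero_le _) fun s hs =>
    ⟨hs.peak, hs.stash, hs.chunk, by simp, hs.bucket, hs.queue⟩) fun _ => ?_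
  refine Triple.bind (memInv_unstash (Nat.zero_le _) (by omega)) fun _ => ?_
  refine Triple.bind (Q := fun _ => MemInv 0) (Triple.forM_const fun i => ?_) fun _ =>
    memInv_flush (Nat.zero_le _) (by omega) _
  split_ifs
  · refine Triple.bind (Q := fun _ => MemInv 0) (Triple.intro fun s hs => ⟨_, _, rfl, ?_⟩)
      fun a => memInv_place (Nat.zero_le _) _ _
    exact ⟨hs.stash, hs.chunk, hs.targets, hs.bucket, hs.queue, hs.peak⟩
  · exact (Triple.pure ()).conseq (fun _ h => h) fun _ _ h => h.2

theorem memInv_importIntermediate (ω : Coins p) (b : Fin p.B) :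
    Triple (MemInv 0) (importIntermediate ω b : Proc p N α _) (fun _ => MemInv 0) PeakLe := by
  unfold importIntermediate
  -- The index of `MemInv` is the loop counter: after `i` reads the loaded bucket has `i` cells.
  refine Triple.bind (Triple.forM_range MemInv fun i hi => ?_) fun _ => ?_
  · refine Triple.bind (Q := fun _ => MemInv i) (Triple.intro fun s hs => ⟨_, _, rfl, ?_⟩)
      fun x => memInv_privately (i + 1) _ hi fun s hs =>
        ⟨hs.peak, hs.stash, hs.chunk, hs.targets, by simp [hs.bucket], hs.queue⟩
    exact ⟨hs.stash, hs.chunk, hs.targets, hs.bucket, hs.queue, hs.peak⟩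
  refine Triple.bind (Q := fun _ => MemInv p.midSize) (memInv_privately _ _ le_rfl fun s hs =>
    ⟨hs.peak, hs.stash, hs.chunk, hs.targets, by simp, hs.queue⟩) fun _ => ?_
  refine Triple.bind Triple.getPrivate fun m => ?_
  refine Triple.bind (Q := fun _ => MemInv p.midSize) ?_ fun _ =>
    memInv_privately _ _ (Nat.zero_le _) fun s hs =>
      ⟨hs.peak, hs.stash, hs.chunk, hs.targets, rfl, hs.queue⟩
  refine Triple.conseq (P := MemInv p.midSize) (Triple.forM_const fun x => ?_)
    (fun s hs => hs.2) fun _ _ h => h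
  cases x with
  | none => exact (Triple.pure ()).conseq (fun _ h => h) fun _ _ h => h.2
  | some a =>
    refine Triple.bind Triple.getPrivate fun m => ?_
    split_ifs with h
    · refine memInv_privately _ _ le_rfl fun s hs => ?_
      obtain ⟨rfl, hs⟩ := hs
      refine ⟨hs.peak, hs.stash, hs.chunk, hs.targets, hs.bucket, ?_⟩
      simpa using h
    · exact Triple.failure fun s hs => hs.2.peak

theorem memInv_drainQueue (b : ℕ) :
    Triple (MemInv 0) (drainQueue b : Proc p N α _) (fun _ => MemInv 0) PeakLe := by
  unfold drainQueue
  refine Triple.forM_const fun i => ?_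
  split_ifs
  · refine Triple.bind (Q := fun _ => MemInv 0) ?_ fun a =>
      Triple.intro fun s hs => ⟨_, _, rfl, ?_⟩
    · refine Triple.bind Triple.getPrivate fun m => ?_
      cases h : m.queue with
      | nil => exact Triple.failure fun s hs => hs.2.peak
      | cons a q =>
        refine Triple.bind (Q := fun _ => MemInv 0) (memInv_privately _ _ (Nat.zero_le _)
          fun s hs => ?_) fun _ => (Triple.pure a).conseq (fun _ h => h) fun _ _ h => h.2
        obtain ⟨rfl, hs⟩ := hs
        refine ⟨hs.peak, hs.stash, hs.chunk, hs.targets, hs.bucket, ?_⟩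
        have := hs.queue
        rw [h, List.length_cons] at this
        dsimp only
        omega
    · exact ⟨hs.stash, hs.chunk, hs.targets, hs.bucket, hs.queue, hs.peak⟩
  · exact (Triple.pure ()).conseq (fun _ h => h) fun _ _ h => h.2

theorem memInv_stashShuffle (ω : Coins p) :
    Triple (MemInv 0) (stashShuffle ω : Proc p N α _) (fun _ => MemInv 0) PeakLe := by
  unfold stashShuffle
  refine Triple.bind (Triple.forM_const fun b => memInv_distributeBucket _ _) fun _ => ?_
  refine Triple.bind (Q := fun _ => MemInv 0) (Triple.bind (memInv_unstash (Nat.zero_le _)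
    (by omega)) fun _ => memInv_flush (Nat.zero_le _) (by omega) _) fun _ => ?_
  refine Triple.bind Triple.getPrivate fun m => ?_
  split_ifs
  · refine Triple.conseq (P := MemInv 0) ?_ (fun s hs => hs.2) fun _ _ h => h
    unfold compress
    refine Triple.bind (Triple.forM_const fun b => memInv_importIntermediate _ _) fun _ => ?_
    refine Triple.bind (Triple.forM_const fun b => ?_) fun _ =>
      Triple.forM_const fun b => memInv_drainQueue _
    exact Triple.bind (memInv_drainQueue _) fun _ => memInv_importIntermediate _ _
  · exact Triple.failure fun s hs => hs.2.peak

theorem memInv_initialState (x : Fin N → α) : MemInv 0 (initialState p x) := by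
  have h1 : (Private.empty p α).stashSize ≤ p.S := by simp [Private.stashSize, Private.empty]
  -- Even the empty stash costs one word for each of its `B` list lengths, and the peak never
  -- decreases.
  have h2 : p.B ≤ (Private.empty p α).words := by
    simp only [Private.words, Private.empty, List.length_nil, zero_add, Finset.sum_const,
      Finset.card_univ, Fintype.card_fin, smul_eq_mul, mul_one]
    omega
  have h3 : (Private.empty p α).words ≤ memBound p :=
    words_le h1 (fun j => by simp [Private.empty]) (by simp [Private.empty])
      (by simp [Private.empty]) (by simp [Private.empty])
  exact ⟨h1, fun j => by simp [initialState, Private.empty],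
      by simp [initialState, Private.empty], by simp [initialState, Private.empty],
      by simp [initialState, Private.empty], h2, h3⟩

theorem peakMemory_mem (x : Fin N → α) (ω : Coins p) :
    p.B ≤ peakMemory x ω ∧ peakMemory x ω ≤ memBound p := by
  have h := memInv_stashShuffle ω (initialState p x) (memInv_initialState x)
  have e' : peakMemory x ω = (exec (stashShuffle ω) (initialState p x)).2.peak := rfl
  rw [e']
  rcases e : exec (stashShuffle ω) (initialState p x) with ⟨_ | a, s'⟩
  · exact h.2 _ e
  · exact (h.1 _ _ e).peak

theorem privateMemory_le (p : Params) (N : ℕ) : privateMemory p N ≤ memBound p :=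
  Finset.sup_le fun _ _ => (peakMemory_mem _ _).2

/-- The final claim is an equality with `N ^ (1/2 + η N)`, so the exponent must be bounded from
below as well. -/
theorem le_privateMemory (p : Params) (N : ℕ) : p.B ≤ privateMemory p N := by
  refine (peakMemory_mem (id : Fin N → Fin N) (Classical.arbitrary (Coins p))).1.trans ?_
  unfold privateMemory
  exact Finset.le_sup (f := fun xω : (Fin N → Fin N) × Coins p => peakMemory xω.1 xω.2)
      (b := ((id : Fin N → Fin N), Classical.arbitrary (Coins p))) (Finset.mem_univ _)

end Memory

/-! ### Distribution phase: on good targets the stash does not fail -/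

section Distribution

variable {p : Params} {N : ℕ} {α β γ : Type}

/-- Total correctness: no failure from states in `P`. -/
abbrev Total (P : State p N α → Prop) (x : Proc p N α β) (Q : β → State p N α → Prop) : Prop :=
  Triple P x Q fun _ => False

theorem Total.exists {P : State p N α → Prop} {x : Proc p N α β} {Q : β → State p N α → Prop}
    (h : Total P x Q) {s : State p N α} (hs : P s) : ∃ a s', exec x s = (some a, s') ∧ Q a s' := by
  rcases e : exec x s with ⟨_ | a, s'⟩
  · exact ((h s hs).2 _ e).elim
  · exact ⟨a, s', rfl, (h s hs).1 _ _ e⟩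

/-- The items among the first `n` cells of an intermediate bucket. -/
def midItems (f : ℕ → Option α) (n : ℕ) : Multiset α := ((List.range n).map f).reduceOption

theorem reduceOption_map_some (l : List α) : (l.map some).reduceOption = l := by
  induction l with
  | nil => rfl
  | cons a l ih => rw [List.map_cons, List.reduceOption_cons_of_some, ih]

theorem map_range_getD (l : List (Option α)) (cap : ℕ) (h : l.length ≤ cap) :
    (List.range cap).map (fun i => l.getD i none) =
      l ++ List.replicate (cap - l.length) none := by
  refine List.ext_getElem (by simp; omega) fun i h1 h2 => ?_
  simp only [List.getElem_map, List.getElem_range, List.getD_eq_getElem?_getD]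
  by_cases hi : i < l.length
  · simp [List.getElem_append_left hi, hi]
  · rw [List.getElem_append_right (by omega)]
    simp [List.getElem?_eq_none (not_lt.1 hi)]

/-- Dummies disappear under `reduceOption`, so a padded write adds exactly the items of the chunk.
-/
theorem midItems_flush {f f' : ℕ → Option α} {off cap : ℕ} {l : List (Option α)}
    (hl : l.length ≤ cap)
    (hf : ∀ i, f' i = if off ≤ i ∧ i < off + cap then l.getD (i - off) none else f i) :
    midItems f' (off + cap) = midItems f off + (l.reduceOption : Multiset α) := by
  have e1 : (List.range off).map f' = (List.range off).map f :=
    List.map_congr_left fun i hi => by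
      rw [List.mem_range] at hi
      rw [hf, if_neg (by omega)]
  have e2 : (List.range cap).map (fun i => f' (off + i)) =
      l ++ List.replicate (cap - l.length) none := by
    rw [← map_range_getD l cap hl]
    refine List.map_congr_left fun i hi => ?_
    rw [List.mem_range] at hi
    rw [hf, if_pos (by omega), Nat.add_sub_cancel_left]
  unfold midItems
  rw [List.range_add, List.map_append, List.map_map, e1]
  have e3 : f' ∘ (fun x => off + x) = fun i => f' (off + i) := rfl
  rw [e3, e2, List.reduceOption_append, List.reduceOption_append, List.reduceOption_replicate_none,
    List.append_nil, Multiset.coe_add]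

/-- What `flush` does. -/
theorem total_flush (cap off : ℕ) (s₀ : State p N α) :
    Total (fun s => s = s₀) (flush cap off) fun _ s =>
      s.inp = s₀.inp ∧ s.out = s₀.out ∧
      s.priv = { s₀.priv with targets := [], chunk := fun _ => [] } ∧
      ∀ j i, s.mid j i = if off ≤ i ∧ i < off + cap then (s₀.priv.chunk j).getD (i - off) none
        else s₀.mid j i := by
  unfold flush
  set m₁ : Private p α := { s₀.priv with
    targets := []
    chunk := fun j => s₀.priv.chunk j ++
      List.replicate (cap - (s₀.priv.chunk j).length) none } with hm₁
  -- Progress of the double loop: chunks below `n` are written completely, chunk `n` up to cell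
  -- `i₀`. Thus `I n cap` and `I (n + 1) 0` say the same.
  let I : ℕ → ℕ → State p N α → Prop := fun n i₀ s =>
    s.inp = s₀.inp ∧ s.out = s₀.out ∧ s.priv = m₁ ∧
      ∀ (j : Fin p.B) i, s.mid j i =
        if (j.val < n ∧ off ≤ i ∧ i < off + cap) ∨ (j.val = n ∧ off ≤ i ∧ i < off + i₀) then
          (s₀.priv.chunk j).getD (i - off) none else s₀.mid j i
  refine Triple.bind (Q := fun _ => I 0 0) (Triple.intro fun s hs => ⟨(), _, rfl, ?_⟩) fun _ => ?_
  · subst hs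
    refine ⟨rfl, rfl, rfl, fun j i => ?_⟩
    rw [if_neg (by omega)]
  refine Triple.bind (Q := fun _ => I p.B 0) ?_ fun _ => ?_
  · have := Triple.forM (l := List.finRange p.B) (E := fun _ => False)
      (k := fun j => (List.range cap).forM fun i => do
        let m ← getPrivate
        writeMid j (off + i) ((m.chunk j).getD i none)) (fun n => I n 0) ?_
    · rwa [List.length_finRange] at this
    intro n hn
    refine Triple.conseq (P := I n 0) (Q := fun _ => I n cap) (Triple.forM_range (I n) ?_)
      (fun _ h => h) ?_
    · intro i hi
      refine Triple.bind Triple.getPrivate fun m => ?_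
      refine Triple.intro fun s hs => ⟨(), _, rfl, ?_⟩
      obtain ⟨rfl, h1, h2, h3, h4⟩ := hs
      refine ⟨h1, h2, h3, fun j k => ?_⟩
      simp only [List.getElem_finRange] at *
      by_cases hj : j.val = n
      · have ej : j = Fin.cast List.length_finRange ⟨n, hn⟩ := Fin.ext hj
        rw [← ej]
        simp only [Function.update_self]
        by_cases hk : k = off + i
        · subst hk
          rw [Function.update_self, if_pos (by omega), h3, hm₁, Nat.add_sub_cancel_left]
          simp only [List.getD_eq_getElem?_getD]
          by_cases hl : i < (s₀.priv.chunk j).length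
          · rw [List.getElem?_append_left hl]
          · rw [List.getElem?_append_right (by omega), List.getElem?_eq_none (l := s₀.priv.chunk j) (i := i) (by omega),
              List.getElem?_replicate]
            split_ifs <;> rfl
        · rw [Function.update_of_ne hk, h4]
          congr 1
          simp only [eq_iff_iff]
          omega
      · rw [Function.update_of_ne (fun h => hj (by rw [h]; rfl)), h4]
        congr 1
        simp only [eq_iff_iff]
        omega
    · rintro _ s ⟨h1, h2, h3, h4⟩
      refine ⟨h1, h2, h3, fun j i => ?_⟩
      rw [h4]
      congr 1
      simp only [eq_iff_iff]
      omega
  · refine Triple.intro fun s hs => ⟨(), _, rfl, ?_⟩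
    obtain ⟨h1, h2, h3, h4⟩ := hs
    refine ⟨h1, h2, ?_, fun j i => ?_⟩
    · simp only [h3, hm₁]
    · simp only [h4]
      congr 1
      simp only [eq_iff_iff]
      omega

/-- Number of items with target `j` among those with index in `[lo, hi)`. -/
def cnt (v : Fin N → Fin p.B) (j : Fin p.B) (lo hi : ℕ) : ℕ :=
  (Finset.univ.filter fun k : Fin N => v k = j ∧ lo ≤ k.val ∧ k.val < hi).card

/-- The items with target `j` among the first `hi` ones. -/
def itemsTo (v : Fin N → Fin p.B) (x : Fin N → α) (j : Fin p.B) (hi : ℕ) : Multiset α :=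
  (Finset.univ.filter fun k : Fin N => v k = j ∧ k.val < hi).val.map x

theorem cnt_mono (v : Fin N → Fin p.B) (j : Fin p.B) (lo : ℕ) {hi hi' : ℕ} (h : hi ≤ hi') :
    cnt v j lo hi ≤ cnt v j lo hi' :=
  Finset.card_le_card fun k hk => by
    simp only [Finset.mem_filter, Finset.mem_univ, true_and] at hk ⊢
    omega

theorem cnt_self (v : Fin N → Fin p.B) (j : Fin p.B) (lo : ℕ) : cnt v j lo lo = 0 := by
  unfold cnt
  rw [Finset.card_eq_zero, Finset.filter_eq_empty_iff]
  intro k _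
  omega

theorem cnt_succ (v : Fin N → Fin p.B) (j : Fin p.B) {lo hi : ℕ} (hl : lo ≤ hi) (h : hi < N) :
    cnt v j lo (hi + 1) = cnt v j lo hi + if v ⟨hi, h⟩ = j then 1 else 0 := by
  unfold cnt
  split_ifs with hv
  · rw [← Finset.card_insert_of_notMem (a := (⟨hi, h⟩ : Fin N)) (by simp)]
    congr 1
    ext k
    simp only [Finset.mem_filter, Finset.mem_univ, true_and, Finset.mem_insert, Fin.ext_iff]
    constructor
    · rintro ⟨h1, h2, h3⟩
      omega
    · rintro (h1 | h1)
      · refine ⟨?_, by omega, by omega⟩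
        rw [← hv, show k = ⟨hi, h⟩ from Fin.ext h1]
      · exact ⟨h1.1, by omega, by omega⟩
  · rw [add_zero]
    congr 1
    ext k
    simp only [Finset.mem_filter, Finset.mem_univ, true_and]
    constructor
    · rintro ⟨h1, h2, h3⟩
      refine ⟨h1, h2, lt_of_le_of_ne (by omega) fun e => hv ?_⟩
      rw [← h1, show k = ⟨hi, h⟩ from Fin.ext e]
    · rintro ⟨h1, h2, h3⟩
      exact ⟨h1, h2, by omega⟩

theorem cnt_succ_of_le (v : Fin N → Fin p.B) (j : Fin p.B) {lo hi : ℕ} (h : N ≤ hi) :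
    cnt v j lo (hi + 1) = cnt v j lo hi := by
  unfold cnt
  congr 1
  ext k
  simp only [Finset.mem_filter, Finset.mem_univ, true_and]
  omega

theorem itemsTo_zero (v : Fin N → Fin p.B) (x : Fin N → α) (j : Fin p.B) :
    itemsTo v x j 0 = 0 := by
  simp [itemsTo]

theorem itemsTo_succ (v : Fin N → Fin p.B) (x : Fin N → α) (j : Fin p.B) {hi : ℕ} (h : hi < N) :
    itemsTo v x j (hi + 1) =
      itemsTo v x j hi + if v ⟨hi, h⟩ = j then {x ⟨hi, h⟩} else 0 := by
  unfold itemsTo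
  split_ifs with hv
  · rw [add_comm _ {_}, Multiset.singleton_add, ← Multiset.map_cons,
      ← Finset.insert_val_of_notMem (a := (⟨hi, h⟩ : Fin N)) (by simp)]
    congr 2
    ext k
    simp only [Finset.mem_filter, Finset.mem_univ, true_and, Finset.mem_insert, Fin.ext_iff]
    constructor
    · rintro ⟨h1, h3⟩
      omega
    · rintro (h1 | h1)
      · refine ⟨?_, by omega⟩
        rw [← hv, show k = ⟨hi, h⟩ from Fin.ext h1]
      · exact ⟨h1.1, by omega⟩
  · rw [add_zero]
    congr 2
    ext k
    simp only [Finset.mem_filter, Finset.mem_univ, true_and]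
    constructor
    · rintro ⟨h1, h3⟩
      refine ⟨h1, lt_of_le_of_ne (by omega) fun e => hv ?_⟩
      rw [← h1, show k = ⟨hi, h⟩ from Fin.ext e]
    · rintro ⟨h1, h3⟩
      exact ⟨h1, by omega⟩

theorem itemsTo_succ_of_le (v : Fin N → Fin p.B) (x : Fin N → α) (j : Fin p.B) {hi : ℕ}
    (h : N ≤ hi) : itemsTo v x j (hi + 1) = itemsTo v x j hi := by
  unfold itemsTo
  congr 2
  ext k
  simp only [Finset.mem_filter, Finset.mem_univ, true_and]
  omega

/-- The targets are such that the stash part of each output bucket never exceeds `κ`. -/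
structure StashGood (p : Params) (v : Fin N → Fin p.B) (κ : ℕ) : Prop where
  cnt_le : ∀ j a b, a ≤ b → b < p.B → cnt v j (a * p.D) ((b + 1) * p.D) ≤ (b + 1 - a) * p.C + κ
  lt_S : p.B * κ < p.S
  le_K : κ ≤ p.K

/-- Invariant between two input buckets, `n` of which have been distributed. -/
structure BucketInv (v : Fin N → Fin p.B) (x : Fin N → α) (n : ℕ) (s : State p N α) : Prop where
  inp : s.inp = x
  chunk : s.priv.chunk = fun _ => []
  bucket : s.priv.bucket = []
  queue : s.priv.queue = []
  content : ∀ j, midItems (s.mid j) (n * p.C) + (s.priv.stash j : Multiset α) =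
    itemsTo v x j (n * p.D)
  len : ∀ j, ∃ a ≤ n, (s.priv.stash j).length + (n - a) * p.C = cnt v j (a * p.D) (n * p.D)

/-- Invariant within input bucket `b`, `i` slots of which have been distributed. -/
structure SlotInv (v : Fin N → Fin p.B) (x : Fin N → α) (T : List (Fin p.B)) (b i : ℕ)
    (s : State p N α) : Prop where
  inp : s.inp = x
  targets : s.priv.targets = T
  bucket : s.priv.bucket = []
  queue : s.priv.queue = []
  content : ∀ j, midItems (s.mid j) (b * p.C) + ((s.priv.chunk j).reduceOption : Multiset α) +
    (s.priv.stash j : Multiset α) = itemsTo v x j (b * p.D + i)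
  chunk_le : ∀ j, (s.priv.chunk j).length ≤ p.C
  full : ∀ j, s.priv.stash j ≠ [] → (s.priv.chunk j).length = p.C
  len : ∀ j, ∃ a ≤ b, (s.priv.chunk j).length + (s.priv.stash j).length + (b - a) * p.C =
    cnt v j (a * p.D) (b * p.D + i)

/-- This is the busy-period argument. In `len`, the witness `a` marks the start of a period in which
every chunk for `j` left full, so what remains is the number of arrivals minus `C` for each finished
bucket. A nonempty stash part means that the current chunk is full too, which accounts for one more
`C`, and `cnt_le` leaves at most `κ`. -/
theorem SlotInv.length_stash_le {v : Fin N → Fin p.B} {x : Fin N → α} {T : List (Fin p.B)}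
    {b i κ : ℕ} {s : State p N α} (h : SlotInv v x T b i s) (hg : StashGood p v κ)
    (hb : b < p.B) (hi : i ≤ p.D) (j : Fin p.B) : (s.priv.stash j).length ≤ κ := by
  by_cases hs : s.priv.stash j = []
  · simp [hs]
  · obtain ⟨a, ha, e⟩ := h.len j
    have h1 := hg.cnt_le j a b ha hb
    have h2 := cnt_mono v j (a * p.D) (hi := b * p.D + i) (hi' := (b + 1) * p.D)
      (by rw [Nat.succ_mul]; omega)
    rw [h.full j hs] at e
    have h3 : (b + 1 - a) * p.C = (b - a) * p.C + p.C := by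
      rw [show b + 1 - a = b - a + 1 by omega, Nat.succ_mul]
    omega

theorem total_place {v : Fin N → Fin p.B} {x : Fin N → α} {T : List (Fin p.B)}
    {b i κ : ℕ} (hg : StashGood p v κ) (hb : b < p.B) (hi : i < p.D) (h : b * p.D + i < N)
    (hT : T[i]? = some (v ⟨b * p.D + i, h⟩)) :
    Total (SlotInv v x T b i) (place i (x ⟨b * p.D + i, h⟩))
      fun _ => SlotInv v x T b (i + 1) := by
  unfold place
  refine Triple.bind Triple.getPrivate fun m => ?_
  by_cases hm : m.targets = T
  swap
  · intro s hs
    exact (hm (hs.1 ▸ hs.2.targets)).elim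
  rw [hm, hT]
  dsimp only
  set t := v ⟨b * p.D + i, h⟩ with ht
  have hlo : ∀ a, a ≤ b → a * p.D ≤ b * p.D + i := fun a ha =>
    (Nat.mul_le_mul_right _ ha).trans (Nat.le_add_right _ _)
  split_ifs with h1 h2
  · refine Triple.intro fun s hs => ⟨(), _, rfl, ?_⟩
    obtain ⟨rfl, hs⟩ := hs
    refine ⟨hs.inp, hs.targets, hs.bucket, hs.queue, fun j => ?_, fun j => ?_, fun j => ?_,
      fun j => ?_⟩ <;> dsimp only
    · rw [← add_assoc, itemsTo_succ v x j h, ← ht, ← hs.content j]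
      by_cases hj : t = j
      · subst hj
        simp only [Function.update_self, List.reduceOption_append, if_true,
          List.reduceOption_singleton, ← Multiset.coe_add, Option.toList_some,
          Multiset.coe_singleton]
        abel
      · rw [Function.update_of_ne (Ne.symm hj), if_neg hj, add_zero]
    · by_cases hj : j = t
      · subst hj; simpa using h1
      · simpa [hj] using hs.chunk_le j
    · intro hne
      by_cases hj : j = t
      · subst hj
        have := hs.full _ hne
        omega
      · simpa [hj] using hs.full j hne
    · obtain ⟨a, ha, e⟩ := hs.len j
      refine ⟨a, ha, ?_⟩
      rw [← add_assoc, cnt_succ v j (hlo a ha) h, ← ht, ← e]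
      by_cases hj : t = j
      · subst hj
        simp
        omega
      · rw [Function.update_of_ne (Ne.symm hj), if_neg hj, add_zero]
  · refine Triple.intro fun s hs => ⟨(), _, rfl, ?_⟩
    obtain ⟨rfl, hs⟩ := hs
    refine ⟨hs.inp, hs.targets, hs.bucket, hs.queue, fun j => ?_, hs.chunk_le, fun j => ?_,
      fun j => ?_⟩ <;> dsimp only
    · rw [← add_assoc, itemsTo_succ v x j h, ← ht, ← hs.content j]
      by_cases hj : t = j
      · subst hj
        simp only [Function.update_self, if_true, ← Multiset.coe_add, Multiset.coe_singleton]
        abel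
      · rw [Function.update_of_ne (Ne.symm hj), if_neg hj, add_zero]
    · intro hne
      by_cases hj : j = t
      · subst hj
        exact le_antisymm (hs.chunk_le _) (not_lt.1 h1)
      · rw [Function.update_of_ne hj] at hne
        exact hs.full j hne
    · obtain ⟨a, ha, e⟩ := hs.len j
      refine ⟨a, ha, ?_⟩
      rw [← add_assoc, cnt_succ v j (hlo a ha) h, ← ht, ← e]
      by_cases hj : t = j
      · subst hj
        simp
        omega
      · rw [Function.update_of_ne (Ne.symm hj), if_neg hj, add_zero]
  · intro s hs
    obtain ⟨rfl, hs⟩ := hs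
    -- The overflow branch is impossible: the `B` parts hold at most `κ` items each and `B * κ < S`.
    refine (h2 (lt_of_le_of_lt ?_ hg.lt_S)).elim
    refine (Finset.sum_le_card_nsmul _ _ κ fun j _ => hs.length_stash_le hg hb hi.le j).trans ?_
    simp

theorem total_distributeBucket {v : Fin N → Fin p.B} {x : Fin N → α} {κ : ℕ}
    (hg : StashGood p v κ) (ω : Coins p)
    (hv : ∀ (b : Fin p.B) (i : Fin p.D) (h : b * p.D + i < N), v ⟨b * p.D + i, h⟩ = ω.targets b i)
    (b : Fin p.B) :
    Total (BucketInv v x b) (distributeBucket ω b) fun _ => BucketInv v x (b + 1) := by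
  unfold distributeBucket
  let T := List.ofFn (ω.targets b)
  refine Triple.bind (Q := fun _ s => BucketInv v x b s ∧ s.priv.targets = T)
    (Triple.intro fun s hs => ⟨(), _, rfl, ?_⟩) fun _ => ?_
  · exact ⟨⟨hs.inp, hs.chunk, hs.bucket, hs.queue, hs.content, hs.len⟩, rfl⟩
  refine Triple.bind (Q := fun _ => SlotInv v x T b 0)
    (Triple.intro fun s hs => ⟨(), _, rfl, ?_⟩) fun _ => ?_
  · obtain ⟨hs, hT⟩ := hs
    refine ⟨hs.inp, hT, hs.bucket, hs.queue, fun j => ?_, fun j => ?_, fun j => ?_, fun j => ?_⟩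
      <;> dsimp only
    · rw [add_zero, ← hs.content j, reduceOption_map_some, add_assoc, Multiset.coe_add,
        List.take_append_drop]
    · simp
    -- If items stay behind after the transfer, more than `C` were waiting, so the chunk starts
    -- full.
    · intro h
      rw [Ne, List.drop_eq_nil_iff] at h
      simp only [List.length_map, List.length_take]
      omega
    · obtain ⟨a, ha, e⟩ := hs.len j
      refine ⟨a, ha, ?_⟩
      rw [add_zero, ← e]
      simp only [List.length_map, List.length_take, List.length_drop]
      omega
  refine Triple.bind (Triple.forM_range (SlotInv v x T b) fun i hi => ?_) fun _ => ?_
  · split_ifs with h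
    · refine Triple.bind (Q := fun a s => a = x ⟨b * p.D + i, h⟩ ∧ SlotInv v x T b i s)
        (Triple.intro fun s hs => ⟨_, _, rfl, ?_⟩) fun a => ?_
      · exact ⟨by rw [hs.inp], hs.inp, hs.targets, hs.bucket, hs.queue, hs.content, hs.chunk_le,
          hs.full, hs.len⟩
      · by_cases ha : a = x ⟨b * p.D + i, h⟩
        · subst ha
          refine Triple.conseq (total_place hg b.2 hi h ?_) (fun s hs => hs.2) fun _ _ h => h
          rw [hv b ⟨i, hi⟩ h]
          simp [T, hi]
        · exact fun s hs => (ha hs.1).elim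
    -- A slot beyond the last item: its target is drawn but nothing is moved or counted.
    · refine Triple.intro fun s hs => ⟨_, _, rfl, ?_⟩
      refine ⟨hs.inp, hs.targets, hs.bucket, hs.queue, fun j => ?_, hs.chunk_le,
          hs.full, fun j => ?_⟩
      · rw [← add_assoc, itemsTo_succ_of_le v x j (by omega), hs.content]
      · obtain ⟨a, ha, e⟩ := hs.len j
        exact ⟨a, ha, by rw [← add_assoc, cnt_succ_of_le v j (by omega), e]⟩
  · intro s hs
    refine Triple.conseq (total_flush p.C (b * p.C) s) (P' := fun s' => s' = s) (fun _ h => h)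
      (fun _ s' h => ?_) s rfl
    obtain ⟨h1, h2, h3, h4⟩ := h
    have hD : (b.val + 1) * p.D = b * p.D + p.D := Nat.succ_mul _ _
    have hC : (b.val + 1) * p.C = b * p.C + p.C := Nat.succ_mul _ _
    refine ⟨h1.trans hs.inp, by rw [h3], by rw [h3]; exact hs.bucket,
      by rw [h3]; exact hs.queue, fun j => ?_, fun j => ?_⟩
    · rw [h3, hD, ← hs.content j, hC, midItems_flush (hs.chunk_le j) (h4 j)]
    · rw [h3, hD]
      dsimp only
      -- An empty stash part restarts the busy period at `b + 1`. Otherwise the old start is kept,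
      -- and the chunk just written was full and removed exactly `C` items.
      by_cases hn : s.priv.stash j = []
      · refine ⟨b + 1, le_rfl, ?_⟩
        rw [hn, Nat.sub_self, ← hD, cnt_self]
        simp
      · obtain ⟨a, ha, e⟩ := hs.len j
        refine ⟨a, by omega, ?_⟩
        rw [← e, hs.full j hn, show b.val + 1 - a = b - a + 1 by omega, Nat.succ_mul]
        omega

/-- The distribution phase. -/
def distribution (ω : Coins p) : Proc p N α Unit := do
  (List.finRange p.B).forM fun b => distributeBucket ω b
  drainStash

theorem total_distribution (hN : N ≤ p.B * p.D) {v : Fin N → Fin p.B} {x : Fin N → α} {κ : ℕ}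
    (hg : StashGood p v κ) (ω : Coins p)
    (hv : ∀ (b : Fin p.B) (i : Fin p.D) (h : b * p.D + i < N),
      v ⟨b * p.D + i, h⟩ = ω.targets b i) :
    Total (BucketInv v x 0) (distribution ω) fun _ s =>
      s.priv.stashSize = 0 ∧ s.priv.bucket = [] ∧ s.priv.queue = [] ∧
      ∀ j, midItems (s.mid j) p.midSize = itemsTo v x j N := by
  unfold distribution
  refine Triple.bind (Q := fun _ => BucketInv v x p.B) ?_ fun _ => ?_
  · have := Triple.forM (l := List.finRange p.B) (E := fun _ => False)
      (k := fun b => distributeBucket ω b) (BucketInv v x) fun n hn => by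
        have := total_distributeBucket (x := x) hg ω hv ⟨n, by simpa using hn⟩
        simpa using this
    rwa [List.length_finRange] at this
  have hN' : ∀ j, itemsTo v x j (p.B * p.D) = itemsTo v x j N := fun j => by
    unfold itemsTo
    congr 2
    ext k
    simp only [Finset.mem_filter, Finset.mem_univ, true_and]
    omega
  intro s hs
  have hK : ∀ j, (s.priv.stash j).length ≤ p.K := fun j => by
    obtain ⟨a, ha, e⟩ := hs.len j
    rcases Nat.lt_or_ge a p.B with h | h
    -- The busy period extends to the last input bucket; a witness `a = B` instead means that the
    -- stash part is empty.
    · have := hg.cnt_le j a (p.B - 1) (by omega) (by omega)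
      rw [show p.B - 1 + 1 = p.B by omega] at this
      have := hg.le_K
      omega
    · obtain rfl : a = p.B := le_antisymm ha h
      rw [cnt_self] at e
      omega
  unfold drainStash
  refine Triple.bind (P := fun s' => s' = s) (Triple.intro fun s hs => ⟨(), _, rfl, ?_⟩)
    (Q := fun _ s' => s'.priv.stash = (fun _ => []) ∧ s'.priv.bucket = [] ∧ s'.priv.queue = [] ∧
      s'.mid = s.mid ∧ s'.priv.chunk = fun j => (s.priv.stash j).map some)
    (fun _ => ?_) s rfl
  · subst hs
    refine ⟨?_, hs.bucket, hs.queue, rfl, ?_⟩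
    · funext j
      exact List.drop_eq_nil_iff.2 (hK j)
    · funext j
      dsimp only
      rw [List.take_of_length_le (hK j)]
  · rintro s' ⟨g1, g2, g3, g4, g5⟩
    refine Triple.conseq (total_flush p.K (p.C * p.B) s') (P' := fun t => t = s') (fun _ h => h)
      (fun _ t h => ?_) s' rfl
    obtain ⟨h1, h2, h3, h4⟩ := h
    rw [h3]
    refine ⟨?_, g2, g3, fun j => ?_⟩
    · simp [Private.stashSize, g1]
    · unfold Params.midSize
      rw [midItems_flush _ (h4 j), g5, g4, reduceOption_map_some, ← hN' j, ← hs.content j,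
        mul_comm p.C]
      rw [g5]
      simpa using hK j

end Distribution

/-! ### Compression phase: the queue as a window of the final output -/

section Compression

variable {p : Params} {N : ℕ} {α : Type}

/-- The items of intermediate bucket `b` in the order in which they are exported. -/
def exported (mid : Fin p.B → ℕ → Option α) (ω : Coins p) (b : Fin p.B) : List α :=
  (List.ofFn fun i : Fin p.midSize => mid b (ω.perms b i)).reduceOption

/-- Invariant of the compression phase: of the final output `F`, the first `m` items have been
imported and the first `d` have been exported. -/
structure CompressInv (mid : Fin p.B → ℕ → Option α) (F : List α) (m d : ℕ)
    (s : State p N α) : Prop where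
  mid : s.mid = mid
  bucket : s.priv.bucket = []
  queue : s.priv.queue = (F.take m).drop d
  out : ∀ i : Fin N, i.val < d → s.out i = F[i.val]?

/-- The queue is always the segment of `F` between the exported and the imported items, so an import
merely advances its right end. `hq` says that the queue fits once the whole bucket is in. -/
theorem total_importIntermediate {mid : Fin p.B → ℕ → Option α} {F : List α} {m d : ℕ}
    (ω : Coins p) (b : Fin p.B) (hm : m ≤ F.length) (hd : d ≤ m)
    (hF : F.take (m + (exported mid ω b).length) = F.take m ++ exported mid ω b)
    (hq : m + (exported mid ω b).length ≤ d + (p.W * p.D + p.Q)) :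
    Total (CompressInv mid F m d : State p N α → Prop) (importIntermediate ω b)
      fun _ => CompressInv mid F (m + (exported mid ω b).length) d := by
  unfold importIntermediate
  let I : List (Option α) → List α → State p N α → Prop := fun l q s =>
    s.mid = mid ∧ s.priv.bucket = l ∧ s.priv.queue = q ∧ ∀ i : Fin N, i.val < d → s.out i = F[i.val]?
  set q₀ := (F.take m).drop d with hq₀
  set l₀ := List.ofFn fun i : Fin p.midSize => mid b (ω.perms b i) with hl₀
  have hlen : q₀.length = m - d := by
    rw [hq₀, List.length_drop, List.length_take, min_eq_left hm]
  refine Triple.bind (Q := fun _ => I ((List.range p.midSize).map (mid b)) q₀) ?_ fun _ => ?_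
  · refine Triple.conseq (P := I ((List.range 0).map (mid b)) q₀)
      (Triple.forM_range (fun i => I ((List.range i).map (mid b)) q₀) fun i hi => ?_)
      (fun s hs => ⟨hs.mid, hs.bucket, hs.queue, hs.out⟩) fun _ _ h => h
    refine Triple.intro fun s hs => ⟨(), _, rfl, ?_⟩
    obtain ⟨h1, h2, h3, h4⟩ := hs
    refine ⟨h1, ?_, h3, h4⟩
    dsimp only
    rw [h2, h1, List.range_succ, List.map_append]
    rfl
  refine Triple.bind (Q := fun _ => I l₀ q₀) (Triple.intro fun s hs => ⟨(), _, rfl, ?_⟩) fun _ => ?_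
  · obtain ⟨h1, h2, h3, h4⟩ := hs
    refine ⟨h1, ?_, h3, h4⟩
    simp only [h2, hl₀]
    congr 1
    funext i
    simp [List.getD_eq_getElem?_getD]
  refine Triple.bind Triple.getPrivate fun pm => ?_
  by_cases hpm : pm.bucket = l₀
  swap
  · intro s hs
    exact (hpm (hs.1 ▸ hs.2.2.1)).elim
  rw [hpm]
  refine Triple.bind (Q := fun _ => I l₀ (q₀ ++ l₀.reduceOption)) ?_ fun _ =>
    Triple.intro fun s hs => ⟨(), _, rfl, ?_⟩
  · have hI := Triple.forM (l := l₀) (E := fun _ => False)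
      (k := fun x : Option α => (match x with
        | none => pure ()
        | some a => enqueue a : Proc p N α Unit))
      (fun i => I l₀ (q₀ ++ (l₀.take i).reduceOption)) ?_
    · refine Triple.conseq hI (fun s hs => ?_) (fun _ s hs => ?_)
      · simpa using hs.2
      · simpa using hs
    intro i hi
    have ht : (l₀.take (i + 1)).reduceOption =
        (l₀.take i).reduceOption ++ l₀[i].toList := by
      rw [List.take_add_one, List.reduceOption_append]
      simp only [List.getElem?_eq_getElem hi, Option.toList_some, List.reduceOption_singleton]
    -- A partial import is never longer than the complete one, so the capacity hypothesis for the
    -- whole bucket excludes failure at each item.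
    have hle : ((l₀.take (i + 1)).reduceOption).length ≤ l₀.reduceOption.length := by
      conv_rhs => rw [← List.take_append_drop (i + 1) l₀, List.reduceOption_append,
        List.length_append]
      exact Nat.le_add_right _ _
    rw [ht]
    rw [ht] at hle
    cases hx : l₀[i] with
    | none =>
      refine Triple.intro fun s hs => ⟨(), _, rfl, ?_⟩
      simpa using hs
    | some a =>
      rw [hx] at hle
      refine Triple.bind Triple.getPrivate fun m' => ?_
      split_ifs with hcap
      · refine Triple.intro fun s hs => ⟨(), _, rfl, ?_⟩
        obtain ⟨-, h1, h2, h3, h4⟩ := hs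
        exact ⟨h1, h2, by simp [h3], h4⟩
      · intro s hs
        obtain ⟨rfl, h1, h2, h3, h4⟩ := hs
        have hex : (exported mid ω b).length = l₀.reduceOption.length := rfl
        rw [h3, List.length_append, hlen] at hcap
        simp only [List.length_append, Option.toList_some, List.length_singleton] at hle
        omega
  · obtain ⟨h1, h2, h3, h4⟩ := hs
    refine ⟨h1, rfl, ?_, h4⟩
    dsimp only
    rw [h3, hF, List.drop_append_of_le_length, hq₀]
    · rfl
    · rw [List.length_take, min_eq_left hm]
      exact hd

/-- An export advances the left end of the window. The minimum with `N` accounts for output buckets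
that are short or empty because `B * D` may exceed `N`. -/
theorem total_drainQueue {mid : Fin p.B → ℕ → Option α} {F : List α} {m : ℕ}
    (hm : m ≤ F.length) (b : ℕ) (hb : min ((b + 1) * p.D) N ≤ m) :
    Total (CompressInv mid F m (min (b * p.D) N) : State p N α → Prop) (drainQueue b)
      fun _ => CompressInv mid F m (min ((b + 1) * p.D) N) := by
  unfold drainQueue
  rw [Nat.succ_mul] at *
  refine Triple.forM_range (fun i => CompressInv mid F m (min (b * p.D + i) N)) fun i hi => ?_
  split_ifs with h
  · have h1 : min (b * p.D + i) N = b * p.D + i := by omega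
    have h2 : min (b * p.D + (i + 1)) N = b * p.D + i + 1 := by omega
    rw [h1, h2]
    have hlt : b * p.D + i < F.length := by omega
    refine Triple.bind (Q := fun a s => a = F[b * p.D + i] ∧ s.mid = mid ∧ s.priv.bucket = [] ∧
      s.priv.queue = (F.take m).drop (b * p.D + i + 1) ∧
      ∀ k : Fin N, k.val < b * p.D + i → s.out k = F[k.val]?) ?_ fun a =>
        Triple.intro fun s hs => ⟨(), _, rfl, ?_⟩
    · refine Triple.bind Triple.getPrivate fun pm => ?_
      cases hpm : pm.queue with
      | nil =>
        intro s hs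
        exfalso
        obtain ⟨rfl, hs⟩ := hs
        have := hs.queue
        rw [hpm] at this
        have := congrArg List.length this
        simp only [List.length_nil, List.length_drop, List.length_take] at this
        omega
      | cons a q =>
        refine Triple.intro fun s hs => ⟨a, _, rfl, ?_⟩
        obtain ⟨rfl, hs⟩ := hs
        have := hs.queue
        rw [hpm, List.drop_eq_getElem_cons (by rw [List.length_take]; omega),
          List.getElem_take, List.cons.injEq] at this
        exact ⟨this.1, hs.mid, hs.bucket, this.2, hs.out⟩
    · obtain ⟨h0, h1, h2, h3, h4⟩ := hs
      refine ⟨h1, h2, h3, fun k hk => ?_⟩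
      by_cases hk' : k = ⟨b * p.D + i, h⟩
      · subst hk'
        simp [h0, hlt]
      · have : k.val ≠ b * p.D + i := fun e => hk' (Fin.ext e)
        dsimp only
        rw [Function.update_of_ne hk', h4 k (by omega)]
  · have h2 : min (b * p.D + (i + 1)) N = min (b * p.D + i) N := by omega
    rw [h2]
    exact Triple.intro fun s hs => ⟨(), _, rfl, hs⟩

/-- The final output. -/
def finalList (mid : Fin p.B → ℕ → Option α) (ω : Coins p) : List α :=
  (List.finRange p.B).flatMap (exported mid ω)

/-- Number of items in the first `n` intermediate buckets. -/
def importedCount (mid : Fin p.B → ℕ → Option α) (ω : Coins p) (n : ℕ) : ℕ :=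
  (((List.finRange p.B).take n).flatMap (exported mid ω)).length

theorem take_finalList (mid : Fin p.B → ℕ → Option α) (ω : Coins p) (n : ℕ) :
    (finalList mid ω).take (importedCount mid ω n) =
      ((List.finRange p.B).take n).flatMap (exported mid ω) := by
  unfold finalList importedCount
  conv_lhs => rw [← List.take_append_drop n (List.finRange p.B), List.flatMap_append]
  rw [List.take_append_of_le_length (by simp), List.take_of_length_le (by simp)]

theorem importedCount_le (mid : Fin p.B → ℕ → Option α) (ω : Coins p) (n : ℕ) :
    importedCount mid ω n ≤ (finalList mid ω).length := by
  unfold finalList importedCount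
  conv_rhs => rw [← List.take_append_drop n (List.finRange p.B), List.flatMap_append,
    List.length_append]
  exact Nat.le_add_right _ _

theorem take_succ_flatMap (mid : Fin p.B → ℕ → Option α) (ω : Coins p) (n : ℕ) (hn : n < p.B) :
    ((List.finRange p.B).take (n + 1)).flatMap (exported mid ω) =
      ((List.finRange p.B).take n).flatMap (exported mid ω) ++ exported mid ω ⟨n, hn⟩ := by
  rw [List.take_add_one, List.flatMap_append, List.getElem?_eq_getElem (by simpa using hn)]
  simp

theorem importedCount_succ (mid : Fin p.B → ℕ → Option α) (ω : Coins p) (n : ℕ) (hn : n < p.B) :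
    importedCount mid ω (n + 1) = importedCount mid ω n + (exported mid ω ⟨n, hn⟩).length := by
  unfold importedCount
  rw [take_succ_flatMap _ _ _ hn, List.length_append]

/-- The queue neither overflows nor underflows. -/
structure QueueGood (p : Params) (N : ℕ) (M : ℕ → ℕ) : Prop where
  le_cap : ∀ b < p.B, M (b + 1) ≤ min ((b + 1 - min p.W p.B) * p.D) N + (p.W * p.D + p.Q)
  enough : ∀ b, min p.W p.B ≤ b → b < p.B → min ((b + 1 - min p.W p.B) * p.D) N ≤ M b

/-- In the middle loop, after `n` rounds the first `L + n` intermediate buckets are imported and the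
first `n` output buckets exported. `enough` rules out underflow of each drain and `le_cap` overflow
of each import; in the last loop all items are already imported. -/
theorem total_compress (hN : N ≤ p.B * p.D) {mid : Fin p.B → ℕ → Option α} (ω : Coins p)
    (hlen : (finalList mid ω).length = N) (hg : QueueGood p N (importedCount mid ω)) :
    Total (CompressInv mid (finalList mid ω) 0 0 : State p N α → Prop) (compress ω)
      fun _ s => ∀ i : Fin N, s.out i = (finalList mid ω)[i.val]? := by
  unfold compress
  set L := min p.W p.B with hL
  have hLB : L ≤ p.B := min_le_right _ _
  set F := finalList mid ω with hF
  set M := importedCount mid ω with hM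
  have hMF : ∀ n, M n ≤ F.length := importedCount_le mid ω
  have hM0 : M 0 = 0 := by simp [hM, importedCount]
  have himp : ∀ (b : Fin p.B) d, d ≤ M b → M (b + 1) ≤ d + (p.W * p.D + p.Q) →
      Total (CompressInv mid F (M b) d : State p N α → Prop) (importIntermediate ω b)
        fun _ => CompressInv mid F (M (b + 1)) d := by
    intro b d h1 h2
    have e := importedCount_succ mid ω b b.2
    rw [← hM] at e
    rw [e] at h2 ⊢
    refine total_importIntermediate ω b (hMF _) h1 ?_ h2
    have e2 := take_finalList mid ω (b + 1)
    rw [← hM, e] at e2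
    rw [hF, e2, take_succ_flatMap mid ω b b.2, hM, take_finalList]
  refine Triple.bind (Q := fun _ => CompressInv mid F (M L) 0) ?_ fun _ => ?_
  · have := Triple.forM (l := (List.finRange p.B).take L) (E := fun _ => False)
      (k := fun b => (importIntermediate ω b : Proc p N α Unit))
      (fun n => CompressInv mid F (M n) 0) ?_
    · rw [hM0, List.length_take, List.length_finRange, min_eq_left hLB] at this
      exact this
    intro n hn
    rw [List.length_take, List.length_finRange, min_eq_left hLB] at hn
    rw [List.getElem_take, List.getElem_finRange]
    refine himp ⟨n, by omega⟩ 0 (Nat.zero_le _) ?_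
    have := hg.le_cap n (by omega)
    rw [← hL, show n + 1 - L = 0 by omega] at this
    simpa using this
  refine Triple.bind (Q := fun _ => CompressInv mid F N (min ((p.B - L) * p.D) N)) ?_ fun _ => ?_
  · have := Triple.forM (l := (List.finRange p.B).drop L) (E := fun _ => False)
      (k := fun b : Fin p.B => ((do
        drainQueue (b - L)
        importIntermediate ω b) : Proc p N α Unit))
      (fun n => CompressInv mid F (M (L + n)) (min (n * p.D) N)) ?_
    · rw [zero_mul, Nat.zero_min, add_zero, List.length_drop, List.length_finRange,
        show L + (p.B - L) = p.B by omega] at this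
      have h1 : M p.B = N := by
        rw [← hlen, hM, hF, importedCount, finalList, List.take_of_length_le]
        simp
      rw [h1] at this
      exact this
    intro n hn
    rw [List.length_drop, List.length_finRange] at hn
    rw [List.getElem_drop, List.getElem_finRange]
    refine Triple.bind (Q := fun _ => CompressInv mid F (M (L + n)) (min ((n + 1) * p.D) N))
      ?_ fun _ => ?_
    · have h1 := hg.enough (L + n) (by omega) (by omega)
      rw [← hL, show L + n + 1 - L = n + 1 by omega] at h1
      have := total_drainQueue (p := p) (N := N) (mid := mid) (hMF (L + n)) n h1
      simpa using this
    · refine himp ⟨L + n, by omega⟩ _ ?_ ?_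
      · have h1 := hg.enough (L + n) (by omega) (by omega)
        rwa [← hL, show L + n + 1 - L = n + 1 by omega] at h1
      · have h1 := hg.le_cap (L + n) (by omega)
        rwa [← hL, show L + n + 1 - L = n + 1 by omega] at h1
  · have := Triple.forM (l := (List.finRange p.B).drop (p.B - L)) (E := fun _ => False)
      (k := fun b : Fin p.B => (drainQueue b : Proc p N α Unit))
      (fun n => CompressInv mid F N (min ((p.B - L + n) * p.D) N)) ?_
    · refine Triple.conseq this (fun _ h => h) fun _ s hs => ?_
      rw [List.length_drop, List.length_finRange,
        show p.B - L + (p.B - (p.B - L)) = p.B by omega, min_eq_right hN] at hs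
      exact fun i => hs.out i i.2
    intro n hn
    rw [List.length_drop, List.length_finRange] at hn
    rw [List.getElem_drop, List.getElem_finRange]
    exact total_drainQueue hlen.ge (p.B - L + n) (min_le_right _ _)

/-- The permutations are not used before compression, so the intermediate array is a function of the
targets alone. The counting below relies on this to treat targets and permutations separately. -/
theorem distribution_congr {ω ω' : Coins p} (h : ω.targets = ω'.targets) :
    (distribution ω : Proc p N α Unit) = distribution ω' := by
  unfold distribution
  have : ∀ b, (distributeBucket ω b : Proc p N α Unit) = distributeBucket ω' b := fun b => by
    unfold distributeBucket
    rw [h]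
  simp only [this]

/-- The intermediate array after the distribution phase. -/
def midArray (x : Fin N → α) (T : Fin p.B → Fin p.D → Fin p.B) : Fin p.B → ℕ → Option α :=
  (exec (distribution ⟨T, fun _ => 1⟩) (initialState p x)).2.mid

theorem exported_perm (mid : Fin p.B → ℕ → Option α) (ω : Coins p) (b : Fin p.B) :
    (exported mid ω b : Multiset α) = midItems (mid b) p.midSize := by
  unfold exported midItems
  rw [Multiset.coe_eq_coe]
  refine List.Perm.filterMap _ ?_
  have e : (List.range p.midSize).map (mid b) = List.ofFn fun i : Fin p.midSize => mid b i :=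
    List.ext_getElem (by simp) fun i h1 h2 => by simp
  rw [e]
  exact Equiv.Perm.ofFn_comp_perm (ω.perms b) fun i : Fin p.midSize => mid b i

/-- On good targets the shuffle succeeds, and its output is the concatenation of the permuted
intermediate buckets. -/
theorem output_of_good (hN : N ≤ p.B * p.D) {v : Fin N → Fin p.B} (x : Fin N → α) {κ : ℕ}
    (hg : StashGood p v κ) (ω : Coins p)
    (hv : ∀ (b : Fin p.B) (i : Fin p.D) (h : b * p.D + i < N),
      v ⟨b * p.D + i, h⟩ = ω.targets b i)
    (hq : QueueGood p N fun n => (Finset.univ.filter fun k : Fin N => (v k).val < n).card) :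
    (∀ j, (exported (midArray x ω.targets) ω j : Multiset α) = itemsTo v x j N) ∧
    (finalList (midArray x ω.targets) ω).length = N ∧
    output x ω = some fun i => (finalList (midArray x ω.targets) ω)[i.val]? := by
  have h0 : BucketInv v x 0 (initialState p x) := by
    refine ⟨rfl, rfl, rfl, rfl, fun j => ?_, fun j => ⟨0, le_rfl, ?_⟩⟩
    · rw [zero_mul, zero_mul, itemsTo_zero]
      rfl
    · rw [cnt_self]
      simp [initialState, Private.empty]
  obtain ⟨_, s, hs, h1, h2, h3, h4⟩ := Total.exists (total_distribution hN hg ω hv) h0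
  have hmid : midArray x ω.targets = s.mid := by
    unfold midArray
    rw [distribution_congr (ω := ⟨ω.targets, fun _ => 1⟩) (ω' := ω) rfl, hs]
  rw [hmid]
  have he : ∀ j, (exported s.mid ω j : Multiset α) = itemsTo v x j N := fun j => by
    rw [exported_perm, h4]
  have hl : ∀ j, (exported s.mid ω j).length =
      (Finset.univ.filter fun k : Fin N => v k = j).card := fun j => by
    rw [← Multiset.coe_card, he, itemsTo, Multiset.card_map, ← Finset.card_def]
    simp
  -- The queue lengths are governed by the targets only, which turns the queue conditions into a
  -- property of `v`.
  have hM : ∀ n ≤ p.B, importedCount s.mid ω n =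
      (Finset.univ.filter fun k : Fin N => (v k).val < n).card := by
    intro n
    induction n with
    | zero => simp [importedCount]
    | succ n ih =>
      intro hn
      rw [importedCount_succ _ _ _ hn, ih (by omega), hl,
        ← Finset.card_union_of_disjoint]
      · congr 1
        ext k
        simp only [Finset.mem_union, Finset.mem_filter, Finset.mem_univ, true_and, Fin.ext_iff]
        omega
      · rw [Finset.disjoint_filter]
        intro k _ h h'
        rw [h'] at h
        simp at h
  have hlen : (finalList s.mid ω).length = N := by
    have := hM p.B le_rfl
    rw [importedCount, List.take_of_length_le (by simp)] at this
    rw [finalList, this]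
    simp
  refine ⟨he, hlen, ?_⟩
  have hq' : QueueGood p N (importedCount s.mid ω) := by
    refine ⟨fun b hb => ?_, fun b h1 h2 => ?_⟩
    · rw [hM _ hb]; exact hq.le_cap b hb
    · rw [hM _ h2.le]; exact hq.enough b h1 h2
  obtain ⟨_, t, ht, ho⟩ := Total.exists (total_compress hN ω hlen hq') (s := s)
    ⟨rfl, h2, by simpa using h3, by simp⟩
  have e : exec (stashShuffle ω) (initialState p x) = (some (), t) := by
    have e1 : (stashShuffle ω : Proc p N α Unit) =
        (distribution ω >>= fun _ => getPrivate >>= fun m =>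
          if m.stashSize = 0 then compress ω else failure) := by
      unfold stashShuffle distribution
      rw [bind_assoc]
    rw [e1, exec_bind_some hs, exec_bind_some (exec_getPrivate s), if_pos h1, ht]
  have e2 : output x ω = (exec (stashShuffle ω) (initialState p x)).1.map
      fun _ => (exec (stashShuffle ω) (initialState p x)).2.out := rfl
  rw [e2, e]
  simp only [Option.map_some, Option.some.injEq]
  funext i
  exact ho i

end Compression

/-! ### Counting permutations with dummies, monotone maps, and unused slots -/

section Counting

open Finset

/-- Number of arguments with value `j`. -/
def fiberCard {κ β : Type} [Fintype κ] [DecidableEq β] (s : κ → β) (j : β) : ℕ :=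
  (univ.filter fun k => s k = j).card

theorem fiberCard_comp_perm {κ β : Type} [Fintype κ] [DecidableEq β] (s : κ → β)
    (σ : Equiv.Perm κ) (j : β) : fiberCard (s ∘ σ) j = fiberCard s j := by
  unfold fiberCard
  refine card_bij (fun k _ => σ k) (fun k hk => by simpa using hk) (fun a _ b _ h => σ.injective h)
    fun b hb => ⟨σ.symm b, by simpa using hb, by simp⟩

/-- Permutations that bring the non-dummies of `l` into one particular order. -/
theorem card_perm_reduceOption_le {m : ℕ} {α : Type} [DecidableEq α] (l : Fin m → Option α)
    (hl : ∀ i j a, l i = some a → l j = some a → i = j) (o : List α) :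
    (univ.filter fun σ : Equiv.Perm (Fin m) => (List.ofFn fun i => l (σ i)).reduceOption = o).card *
      (List.ofFn l).reduceOption.length.factorial ≤ m.factorial := by
  classical
  let P : Fin m → Prop := fun i => (l i).isSome
  have hcard : (List.ofFn l).reduceOption.length = Fintype.card {i // P i} := by
    rw [Fintype.card_subtype, List.reduceOption_length_eq, ← List.countP_eq_length_filter]
    have hd : List.countP Option.isSome (List.ofFn l) =
        List.countP (fun b => decide (b.isSome = true)) (List.ofFn l) := by simp
    rw [hd, ← Multiset.coe_countP, ← Fin.univ_val_map, Multiset.countP_map, card_def, filter_val]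
  rw [hcard, ← Fintype.card_perm, ← card_univ (α := Equiv.Perm {i // P i}), ← card_product]
  -- Composing an admissible `σ` with a permutation `τ` of the non-dummy indices gives a permutation
  -- of all cells. This map is shown to be injective, hence the product of the two cardinalities is
  -- at most `m!`.
  refine (card_le_card_of_injOn (t := univ)
    (fun τ : Equiv.Perm (Fin m) × Equiv.Perm {i // P i} => Equiv.Perm.ofSubtype τ.2 * τ.1)
    (fun _ _ => mem_coe.2 (mem_univ _)) ?_).trans (by rw [card_univ, Fintype.card_perm,
      Fintype.card_fin])
  have hpos : ∀ σ : Equiv.Perm (Fin m), (List.ofFn fun i => l (σ i)).reduceOption.map some =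
      ((List.ofFn σ).filter fun i => (l i).isSome).map l := by
    intro σ
    have e : (List.ofFn fun i => l (σ i)) = (List.ofFn σ).map l := by
      rw [List.map_ofFn]; rfl
    rw [e]
    induction List.ofFn σ with
    | nil => rfl
    | cons a t ih =>
      rw [List.map_cons]
      cases h : l a with
      | none => rw [List.reduceOption_cons_of_none, List.filter_cons_of_neg (by simp [h]), ih]
      | some b =>
        rw [List.reduceOption_cons_of_some, List.filter_cons_of_pos (by simp [h]), List.map_cons,
          List.map_cons, ih, h]
  have hP : ∀ (τ : Equiv.Perm {i // P i}) i, (l (Equiv.Perm.ofSubtype τ i)).isSome = (l i).isSome := by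
    intro τ i
    by_cases h : P i
    · rw [Equiv.Perm.ofSubtype_apply_of_mem τ h]
      exact (τ ⟨i, h⟩).2.trans h.symm
    · rw [Equiv.Perm.ofSubtype_apply_of_not_mem τ h]
  rintro ⟨σ, τ⟩ h1 ⟨σ', τ'⟩ h2 h
  simp only [coe_product, coe_univ, Set.mem_prod, Set.mem_univ, and_true, coe_filter, mem_univ,
    true_and, Set.mem_ofPred_eq] at h1 h2 h
  -- Since the items are distinct, the order `o` determines the order in which the non-dummy indices
  -- appear.
  have hmap : ((List.ofFn σ).filter fun i => (l i).isSome) =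
      (List.ofFn σ').filter fun i => (l i).isSome := by
    have e : ((List.ofFn σ).filter fun i => (l i).isSome).map l =
        ((List.ofFn σ').filter fun i => (l i).isSome).map l := by
      rw [← hpos, ← hpos, h1, h2]
    refine List.ext_getElem (by simpa using congrArg List.length e) fun i h1 h2 => ?_
    have h3 := List.getElem_of_eq e (i := i) (by simpa using h1)
    rw [List.getElem_map, List.getElem_map] at h3
    obtain ⟨a, ha⟩ := Option.isSome_iff_exists.1 (List.mem_filter.1 (List.getElem_mem h1)).2
    exact hl _ _ a ha (h3 ▸ ha)
  have key : ∀ (σ : Equiv.Perm (Fin m)) (τ : Equiv.Perm {i // P i}),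
      (List.ofFn ⇑(Equiv.Perm.ofSubtype τ * σ)).filter (fun i => (l i).isSome) =
        ((List.ofFn σ).filter fun i => (l i).isSome).map (Equiv.Perm.ofSubtype τ) := by
    intro σ τ
    rw [Equiv.Perm.coe_mul, ← List.map_ofFn, List.filter_map]
    congr 1
    refine List.filter_congr fun i _ => ?_
    exact hP τ i
  -- The common index list contains every non-dummy index, so its image under the product reveals
  -- `τ`; cancelling `τ` then gives `σ`.
  have e := key σ τ
  rw [h, key σ' τ', hmap, List.map_inj_left] at e
  have hτ : Equiv.Perm.ofSubtype τ = Equiv.Perm.ofSubtype τ' := by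
    ext i
    by_cases hi : P i
    · refine congrArg Fin.val (e i ?_).symm
      rw [List.mem_filter]
      exact ⟨(List.mem_ofFn).2 ⟨σ'.symm i, by simp⟩, hi⟩
    · rw [Equiv.Perm.ofSubtype_apply_of_not_mem τ hi, Equiv.Perm.ofSubtype_apply_of_not_mem τ' hi]
  rw [hτ] at h
  rw [Equiv.Perm.ofSubtype_injective hτ, mul_left_cancel h]

/-- A monotone sequence is determined by its fibre sizes. -/
theorem Monotone.eq_of_fiberCard {N B : ℕ} {s t : Fin N → Fin B} (hs : Monotone s)
    (ht : Monotone t) (h : fiberCard s = fiberCard t) : s = t := by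
  have hp : (List.ofFn s).Perm (List.ofFn t) := by
    rw [← Multiset.coe_eq_coe, ← Fin.univ_val_map, ← Fin.univ_val_map]
    ext j
    have := congrFun h j
    unfold fiberCard at this
    rw [Multiset.count_map, Multiset.count_map]
    simpa [card_def, filter_val, eq_comm] using this
  refine List.ofFn_injective (List.Perm.eq_of_pairwise (le := (· ≤ ·))
    (fun a b _ _ h1 h2 => le_antisymm h1 h2) ?_ ?_ hp)
  · exact List.pairwise_ofFn.2 fun i j hij => hs hij.le
  · exact List.pairwise_ofFn.2 fun i j hij => ht hij.le

theorem sum_fiberCard {N B : ℕ} (s : Fin N → Fin B) : ∑ j, fiberCard s j = N := by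
  unfold fiberCard
  rw [← card_eq_sum_card_fiberwise (fun _ _ => mem_coe.2 (mem_univ _))]
  simp

-- The multinomial theorem expands `B ^ N`, the `N`-th power of a sum of `B` ones, as the sum of `N!
-- / ∏ k_j!` over all load vectors `k` of total `N`. Monotone maps inject into load vectors through
-- their fibre sizes, and all terms are nonnegative.
open Classical in
theorem sum_monotone_inv_factorial_le (N B : ℕ) :
    ∑ s ∈ univ.filter (fun s : Fin N → Fin B => Monotone s),
      ∏ j, ((fiberCard s j).factorial : ℝ)⁻¹ ≤ (B : ℝ) ^ N / N.factorial := by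
  have h1 := sum_pow_eq_sum_piAntidiag (univ : Finset (Fin B)) (fun _ => (1 : ℝ)) N
  simp only [sum_const, card_univ, Fintype.card_fin, nsmul_eq_mul, mul_one, one_pow,
    prod_const_one] at h1
  have hm : ∀ k ∈ (univ : Finset (Fin B)).piAntidiag N,
      (Nat.multinomial univ k : ℝ) = N.factorial * ∏ j, ((k j).factorial : ℝ)⁻¹ := by
    intro k hk
    have h2 := Nat.multinomial_spec univ k
    rw [(mem_piAntidiag.1 hk).1] at h2
    have h3 : (∏ j, ((k j).factorial : ℝ)) ≠ 0 :=
      prod_ne_zero_iff.2 fun j _ => Nat.cast_ne_zero.2 (Nat.factorial_ne_zero _)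
    rw [prod_inv_distrib, ← h2]
    push_cast
    field_simp
  rw [h1, sum_congr rfl hm, ← mul_sum, mul_div_cancel_left₀ _
    (Nat.cast_ne_zero.2 (Nat.factorial_ne_zero _))]
  rw [← sum_image (f := fun k : Fin B → ℕ => ∏ j, ((k j).factorial : ℝ)⁻¹) (g := fiberCard)
    (fun s hs t ht h => Monotone.eq_of_fiberCard (mem_filter.1 hs).2 (mem_filter.1 ht).2 h)]
  refine sum_le_sum_of_subset_of_nonneg ?_ fun _ _ _ => prod_nonneg fun _ _ => by positivity
  intro k hk
  obtain ⟨s, -, rfl⟩ := mem_image.1 hk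
  exact mem_piAntidiag.2 ⟨sum_fiberCard s, fun _ _ => mem_univ _⟩

/-- Summing a function of the restriction of `u` to an embedded subset. -/
theorem sum_comp_embedding {ι κ β : Type} [Fintype ι] [Fintype κ] [Fintype β] [DecidableEq ι]
    [DecidableEq κ] (e : κ ↪ ι) (F : (κ → β) → ℝ) :
    (∑ u : ι → β, F (u ∘ e)) * (Fintype.card β : ℝ) ^ Fintype.card κ =
      (Fintype.card β : ℝ) ^ Fintype.card ι * ∑ s, F s := by
  classical
  let E : (ι → β) ≃ (κ → β) × (↥(Set.range e)ᶜ → β) :=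
    (Equiv.arrowCongr (((Equiv.ofInjective e e.injective).sumCongr (Equiv.refl _)).trans
      (Equiv.Set.sumCompl (Set.range e))).symm (Equiv.refl β)).trans
      (Equiv.sumArrowEquivProdArrow _ _ _)
  have hE : ∀ u, (E u).1 = u ∘ e := fun u => by
    funext k
    simp [E]
  have hc : Fintype.card ↥(Set.range e)ᶜ + Fintype.card κ = Fintype.card ι := by
    rw [Fintype.card_compl_set, Set.card_range_of_injective e.injective]
    exact Nat.sub_add_cancel (Fintype.card_le_of_embedding e)
  have h1 : ∑ u : ι → β, F (u ∘ e) = ∑ q : (κ → β) × (↥(Set.range e)ᶜ → β), F q.1 :=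
    Fintype.sum_equiv E _ _ fun u => by rw [hE]
  rw [h1, Fintype.sum_prod_type]
  simp only [sum_const, card_univ, Fintype.card_fun, nsmul_eq_mul]
  rw [← mul_sum, ← hc, pow_add]
  push_cast
  ring

end Counting

/-! ### From sub-uniformity on good targets to statistical distance -/

section Distance

open Finset

variable {p : Params} {N : ℕ}

/-- Targets on which the shuffle does not fail. -/
def Good (p : Params) (N κ : ℕ) (v : Fin N → Fin p.B) : Prop :=
  StashGood p v κ ∧ QueueGood p N fun n => (univ.filter fun k : Fin N => (v k).val < n).card

/-- The slot of an item. -/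
def slotEmb (hN : N ≤ p.B * p.D) : Fin N ↪ Fin p.B × Fin p.D :=
  (Fin.castLEEmb hN).trans finProdFinEquiv.symm.toEmbedding

/-- The target of each item. -/
def itemTarget (hN : N ≤ p.B * p.D) (T : Fin p.B → Fin p.D → Fin p.B) : Fin N → Fin p.B :=
  (fun q : Fin p.B × Fin p.D => T q.1 q.2) ∘ slotEmb hN

theorem itemTarget_apply (hN : N ≤ p.B * p.D) (T : Fin p.B → Fin p.D → Fin p.B) (b : Fin p.B)
    (i : Fin p.D) (h : b * p.D + i < N) : itemTarget hN T ⟨b * p.D + i, h⟩ = T b i := by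
  have : slotEmb hN ⟨b * p.D + i, h⟩ = (b, i) := by
    show finProdFinEquiv.symm _ = _
    rw [Equiv.symm_apply_eq]
    refine Fin.ext ?_
    simp only [Fin.castLEEmb_apply, Fin.castLE_mk, finProdFinEquiv_apply_val]
    ring
  simp only [itemTarget, Function.comp_apply, this]

theorem output_of_good' (hN : N ≤ p.B * p.D) (x : Fin N → Fin N) {κ : ℕ} (ω : Coins p)
    (hg : Good p N κ (itemTarget hN ω.targets)) :
    (∀ j, (exported (midArray x ω.targets) ω j : Multiset (Fin N)) =
      itemsTo (itemTarget hN ω.targets) x j N) ∧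
    (finalList (midArray x ω.targets) ω).length = N ∧
    output x ω = some fun i => (finalList (midArray x ω.targets) ω)[i.val]? :=
  output_of_good hN x hg.1 ω (fun b i h => itemTarget_apply hN ω.targets b i h) hg.2

theorem mem_itemsTo {v : Fin N → Fin p.B} {x : Fin N → Fin N} {j : Fin p.B} {a : Fin N} :
    a ∈ itemsTo v x j N ↔ ∃ k, v k = j ∧ x k = a := by
  simp [itemsTo]

theorem nodup_itemsTo (v : Fin N → Fin p.B) (x : Equiv.Perm (Fin N)) (j : Fin p.B) (n : ℕ) :
    (itemsTo v x j n).Nodup :=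
  (Finset.nodup _).map x.injective

theorem card_itemsTo (v : Fin N → Fin p.B) (x : Fin N → Fin N) (j : Fin p.B) :
    (itemsTo v x j N).card = fiberCard v j := by
  rw [itemsTo, Multiset.card_map, ← Finset.card_def, fiberCard]
  simp

/-- On good targets, the output is an arrangement of the items. -/
theorem exists_perm_of_good (hN : N ≤ p.B * p.D) (x : Equiv.Perm (Fin N)) {κ : ℕ} (ω : Coins p)
    (hg : Good p N κ (itemTarget hN ω.targets)) :
    ∃ π : Equiv.Perm (Fin N), output x ω = some fun i => some (π i) := by
  obtain ⟨h1, h2, h3⟩ := output_of_good' hN x ω hg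
  set F := finalList (midArray x ω.targets) ω with hF
  let f : Fin N → Fin N := fun i => F[i.val]
  have hs : Function.Surjective f := by
    intro a
    have : a ∈ F := by
      rw [hF, finalList, List.mem_flatMap]
      refine ⟨itemTarget hN ω.targets (x.symm a), List.mem_finRange _, ?_⟩
      rw [← Multiset.mem_coe, h1, mem_itemsTo]
      exact ⟨x.symm a, rfl, by simp⟩
    obtain ⟨i, hi, e⟩ := List.getElem_of_mem this
    exact ⟨⟨i, h2 ▸ hi⟩, e⟩
  refine ⟨Equiv.ofBijective f ⟨Finite.injective_iff_surjective.2 hs, hs⟩, ?_⟩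
  rw [h3]
  congr 1
  funext i
  rw [List.getElem?_eq_getElem (by rw [h2]; exact i.2)]
  rfl

/-- The exported buckets can be read off from the output. -/
theorem exported_of_output (hN : N ≤ p.B * p.D) (x π : Equiv.Perm (Fin N)) {κ : ℕ} (ω : Coins p)
    (hg : Good p N κ (itemTarget hN ω.targets))
    (ho : output x ω = some fun i => some (π i)) :
    Monotone (itemTarget hN ω.targets ∘ (x.symm ∘ π)) ∧
    ∀ j, exported (midArray x ω.targets) ω j =
      (List.ofFn π).filter fun a => itemTarget hN ω.targets (x.symm a) = j := by
  obtain ⟨h1, h2, h3⟩ := output_of_good' hN x ω hg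
  set F := finalList (midArray x ω.targets) ω with hF
  set v := itemTarget hN ω.targets with hv
  have hmem : ∀ j, ∀ a ∈ exported (midArray x ω.targets) ω j, v (x.symm a) = j := by
    intro j a ha
    rw [← Multiset.mem_coe, h1, mem_itemsTo] at ha
    obtain ⟨k, hk, rfl⟩ := ha
    simpa using hk
  have hFπ : F = List.ofFn π := by
    refine List.ext_getElem (by simp [h2]) fun i hi hi' => ?_
    rw [ho, Option.some.injEq] at h3
    have := congrFun h3 ⟨i, h2 ▸ hi⟩
    dsimp only at this
    rw [List.getElem?_eq_getElem hi, Option.some.injEq] at this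
    rw [← this, List.getElem_ofFn]
  constructor
  · have hpw : (List.ofFn π).Pairwise fun a b => v (x.symm a) ≤ v (x.symm b) := by
      rw [← hFπ, hF, finalList, List.pairwise_flatMap]
      refine ⟨fun j _ => ?_, ?_⟩
      · refine List.pairwise_of_forall_mem_list fun a ha b hb => ?_
        rw [hmem j a ha, hmem j b hb]
      · refine (List.pairwise_lt_finRange _).imp fun {i j} hij a ha b hb => ?_
        rw [hmem i a ha, hmem j b hb]
        exact hij.le
    rw [List.pairwise_ofFn] at hpw
    intro a b hab
    rcases hab.eq_or_lt with rfl | hab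
    · exact le_rfl
    · exact hpw hab
  · intro j
    rw [← hFπ, hF, finalList, List.filter_flatMap]
    have e : ∀ i, (exported (midArray x ω.targets) ω i).filter (fun a => v (x.symm a) = j) =
        if i = j then exported (midArray x ω.targets) ω i else [] := by
      intro i
      split_ifs with hij
      · exact List.filter_eq_self.2 fun a ha => by simp [hmem i a ha, hij]
      · exact List.filter_eq_nil_iff.2 fun a ha => by simp [hmem i a ha, hij]
    simp only [e]
    -- Filtering by target `j` kills every block but the `j`-th, which occurs exactly once.
    have : ∀ l : List (Fin p.B), l.Nodup → l.flatMap (fun i =>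
        if i = j then exported (midArray x ω.targets) ω i else []) =
        if j ∈ l then exported (midArray x ω.targets) ω j else [] := by
      intro l hl
      induction l with
      | nil => rfl
      | cons i l ih =>
        rw [List.nodup_cons] at hl
        rw [List.flatMap_cons, ih hl.2]
        by_cases hij : i = j
        · subst hij; simp [hl.1]
        · simp [hij, Ne.symm hij]
    rw [this _ (List.nodup_finRange _), if_pos (List.mem_finRange _)]

theorem card_coins (p : Params) : (Fintype.card (Coins p) : ℝ) =
    (p.B : ℝ) ^ (p.B * p.D) * (p.midSize.factorial : ℝ) ^ p.B := by
  rw [Fintype.card_congr (coinsEquiv p)]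
  simp only [Fintype.card_prod, Fintype.card_fun, Fintype.card_fin, Fintype.card_perm,
    Nat.cast_mul, Nat.cast_pow]
  rw [← pow_mul, mul_comm p.D]

/-- Counting coins: first the targets, then the permutations. -/
theorem card_filter_coins (R : Coins p → Prop) [DecidablePred R] :
    (univ.filter R).card = ∑ T : Fin p.B → Fin p.D → Fin p.B,
      (univ.filter fun s : Fin p.B → Equiv.Perm (Fin p.midSize) => R ⟨T, s⟩).card := by
  have h := Fintype.sum_equiv (coinsEquiv p) (fun ω => if R ω then 1 else 0)
    (fun t => if R ⟨t.1, t.2⟩ then 1 else 0) (fun _ => rfl)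
  rw [card_filter, h, Fintype.sum_prod_type]
  simp only [card_filter]

/-- The average over the targets of all slots of a function of the targets of the items. -/
theorem sum_itemTarget (hN : N ≤ p.B * p.D) (F : (Fin N → Fin p.B) → ℝ) :
    (∑ T : Fin p.B → Fin p.D → Fin p.B, F (itemTarget hN T)) * (p.B : ℝ) ^ N =
      (p.B : ℝ) ^ (p.B * p.D) * ∑ v, F v := by
  have h := sum_comp_embedding (β := Fin p.B) (slotEmb hN) F
  simp only [Fintype.card_fin, Fintype.card_prod] at h
  rw [← h]
  congr 1
  exact (Fintype.sum_equiv (Equiv.curry (Fin p.B) (Fin p.D) (Fin p.B)) _ _ fun u => rfl).symm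

-- For fixed targets, monotonicity along `π` is forced and each bucket must come out in the order
-- prescribed by `π`; the permutations of different buckets are independent. This gives the weight
-- `F`, whose mean over the targets is at most `1 / N!`. Beyond this, goodness is simply dropped:
-- only an upper bound is needed.
open Classical in
theorem card_good_output_le (hB : 0 < p.B) (hN : N ≤ p.B * p.D) (x π : Equiv.Perm (Fin N)) (κ : ℕ) :
    ((univ.filter fun ω : Coins p => Good p N κ (itemTarget hN ω.targets) ∧
      output x ω = some fun i => some (π i)).card : ℝ) ≤
      Fintype.card (Coins p) / N.factorial := by
  set m := p.midSize with hm
  let F : (Fin N → Fin p.B) → ℝ := fun v =>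
    if Monotone (v ∘ (x.symm ∘ π)) then ∏ j, ((fiberCard v j).factorial : ℝ)⁻¹ else 0
  have hF0 : ∀ v, 0 ≤ F v := fun v => by
    dsimp only [F]
    split_ifs
    · exact prod_nonneg fun _ _ => by positivity
    · exact le_rfl
  have hT : ∀ T : Fin p.B → Fin p.D → Fin p.B,
      ((univ.filter fun s : Fin p.B → Equiv.Perm (Fin p.midSize) =>
        Good p N κ (itemTarget hN T) ∧
          output x (⟨T, s⟩ : Coins p) = some fun i => some (π i)).card : ℝ) ≤
        (m.factorial : ℝ) ^ p.B * F (itemTarget hN T) := by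
    intro T
    set A := univ.filter fun s : Fin p.B → Equiv.Perm (Fin p.midSize) =>
        Good p N κ (itemTarget hN T) ∧
          output x (⟨T, s⟩ : Coins p) = some fun i => some (π i) with hA
    -- Goodness and monotonicity concern the targets only, so a single member of `A` supplies both.
    rcases A.eq_empty_or_nonempty with h | ⟨s₀, hs₀⟩
    · rw [h, card_empty, Nat.cast_zero]
      exact mul_nonneg (by positivity) (hF0 _)
    rw [hA, mem_filter] at hs₀
    obtain ⟨-, hg, ho⟩ := hs₀
    have hmono := (exported_of_output hN x π (⟨T, s₀⟩ : Coins p) hg ho).1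
    dsimp only at hmono
    -- The buckets before shuffling; their contents are read off from the run with identity
    -- permutations.
    let l : (j : Fin p.B) → Fin p.midSize → Option (Fin N) := fun j i => midArray x T j i
    have hl : ∀ j, ((List.ofFn (l j)).reduceOption : Multiset (Fin N)) =
        itemsTo (itemTarget hN T) x j N := fun j =>
      (output_of_good' hN x (⟨T, fun _ => 1⟩ : Coins p) hg).1 j
    have hsub : A ⊆ Fintype.piFinset fun j => univ.filter fun σ : Equiv.Perm (Fin p.midSize) =>
        (List.ofFn fun i => l j (σ i)).reduceOption =
          (List.ofFn π).filter fun a => itemTarget hN T (x.symm a) = j := by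
      intro s hs
      rw [hA, mem_filter] at hs
      rw [Fintype.mem_piFinset]
      intro j
      rw [mem_filter]
      exact ⟨mem_univ _, (exported_of_output hN x π (⟨T, s⟩ : Coins p) hg hs.2.2).2 j⟩
    have hcard := card_le_card hsub
    rw [Fintype.card_piFinset] at hcard
    refine (Nat.cast_le.2 hcard).trans ?_
    dsimp only [F]
    rw [if_pos hmono, Nat.cast_prod]
    have e : (m.factorial : ℝ) ^ p.B = ∏ _j : Fin p.B, (m.factorial : ℝ) := by simp
    rw [e, ← prod_mul_distrib]
    refine prod_le_prod (fun _ _ => Nat.cast_nonneg _) fun j _ => ?_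
    have h1 := card_perm_reduceOption_le (l j) ?_
      ((List.ofFn π).filter fun a => itemTarget hN T (x.symm a) = j)
    · rw [← Multiset.coe_card, hl, card_itemsTo] at h1
      rw [← div_eq_mul_inv, le_div_iff₀ (by positivity)]
      exact_mod_cast h1
    · have hnd : (List.ofFn (l j)).reduceOption.Nodup := by
        rw [← Multiset.coe_nodup, hl]
        exact nodup_itemsTo _ _ _ _
      rw [List.Nodup, List.reduceOption, List.pairwise_filterMap, List.pairwise_ofFn] at hnd
      intro i i' a hi hi'
      rcases lt_trichotomy i i' with hlt | heq | hlt
      · exact (hnd hlt a hi a hi' rfl).elim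
      · exact heq
      · exact (hnd hlt a hi' a hi rfl).elim
  rw [card_filter_coins, Nat.cast_sum]
  refine (sum_le_sum fun T _ => hT T).trans ?_
  rw [← mul_sum, card_coins]
  have hsum := sum_itemTarget hN F
  have hFle : ∑ v, F v ≤ (p.B : ℝ) ^ N / N.factorial := by
    refine le_trans (le_of_eq ?_) (sum_monotone_inv_factorial_le N p.B)
    rw [sum_filter]
    -- Reindexing by the bijection `x.symm ∘ π` turns monotone along `π` into monotone and preserves
    -- fibre sizes.
    refine Fintype.sum_equiv (Equiv.arrowCongr (π.trans x.symm).symm (Equiv.refl _)) _ _ fun v => ?_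
    have e : (Equiv.arrowCongr (π.trans x.symm).symm (Equiv.refl _)) v =
      v ∘ (x.symm ∘ π) := rfl
    have e2 : fiberCard (v ∘ (x.symm ∘ π)) = fiberCard v :=
      funext fun j => fiberCard_comp_perm v (π.trans x.symm) j
    rw [e, e2]
  have hBN : (0 : ℝ) < (p.B : ℝ) ^ N := by positivity
  have h2 : ∑ T : Fin p.B → Fin p.D → Fin p.B, F (itemTarget hN T) ≤
      (p.B : ℝ) ^ (p.B * p.D) / N.factorial := by
    rw [← mul_le_mul_iff_left₀ hBN, hsum]
    refine (mul_le_mul_of_nonneg_left hFle (by positivity)).trans (le_of_eq ?_)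
    ring
  refine (mul_le_mul_of_nonneg_left h2 (by positivity)).trans (le_of_eq ?_)
  rw [hm]
  ring

theorem map_uniform_toReal {Ω Ω' : Type} [Fintype Ω] [Nonempty Ω] [DecidableEq Ω'] (f : Ω → Ω') (a : Ω') :
    ((PMF.uniformOfFintype Ω).map f a).toReal =
      ((univ.filter fun ω => f ω = a).card : ℝ) / Fintype.card Ω := by
  classical
  rw [PMF.map_apply, tsum_fintype]
  simp only [PMF.uniformOfFintype_apply]
  rw [← sum_filter, sum_const, nsmul_eq_mul, ENNReal.toReal_mul, ENNReal.toReal_inv,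
    ENNReal.toReal_natCast, ENNReal.toReal_natCast, div_eq_mul_inv]
  simp only [eq_comm]

/-- A one-sided bound suffices because both laws have mass 1: if `t ≤ e` and `0 ≤ e` then `|t| ≤ 2 *
e - t`, and the differences `t` sum to zero. -/
theorem statDist_le {Ω : Type} [Fintype Ω] (P Q : PMF Ω) (e : Ω → ℝ) (he : ∀ a, 0 ≤ e a)
    (h : ∀ a, (P a).toReal ≤ (Q a).toReal + e a) : statDist P Q ≤ ∑ a, e a := by
  have hs : ∀ R : PMF Ω, ∑ a, (R a).toReal = 1 := fun R => by
    rw [← ENNReal.toReal_sum fun a _ => R.apply_ne_top a, ← tsum_fintype (L := .unconditional _), R.tsum_coe]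
    rfl
  unfold statDist
  have h1 : ∑ a, |(P a).toReal - (Q a).toReal| ≤
      ∑ a, (2 * e a - ((P a).toReal - (Q a).toReal)) := by
    refine sum_le_sum fun a _ => ?_
    have h2 := h a
    have h3 := he a
    rw [abs_le]
    constructor <;> linarith
  rw [sum_sub_distrib, sum_sub_distrib, hs, hs, ← mul_sum] at h1
  linarith

open Classical in
/-- The distance from uniform is at most the probability of bad targets. -/
theorem statDist_outputLaw_le (hB : 0 < p.B) (hN : N ≤ p.B * p.D) (κ : ℕ)
    (x : Equiv.Perm (Fin N)) :
    statDist (outputLaw p x) (uniformLaw N) ≤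
      ((univ.filter fun v : Fin N → Fin p.B => ¬ Good p N κ v).card : ℝ) / (p.B : ℝ) ^ N := by
  have hC : (0 : ℝ) < Fintype.card (Coins p) := Nat.cast_pos.2 Fintype.card_pos
  let Bad : Coins p → Prop := fun ω => ¬ Good p N κ (itemTarget hN ω.targets)
  -- The excess at `a` is the probability of output `a` together with bad targets; it sums to the
  -- probability of bad targets.
  let e : Option (Fin N → Option (Fin N)) → ℝ := fun a =>
    ((univ.filter fun ω : Coins p => Bad ω ∧ output x ω = a).card : ℝ) / Fintype.card (Coins p)
  refine (statDist_le _ _ e (fun a => by positivity) fun a => ?_).trans (le_of_eq ?_)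
  · unfold outputLaw uniformLaw
    rw [map_uniform_toReal, map_uniform_toReal]
    have h1 : (univ.filter fun ω : Coins p => output x ω = a).card =
        (univ.filter fun ω : Coins p => Good p N κ (itemTarget hN ω.targets) ∧
          output x ω = a).card + (univ.filter fun ω : Coins p => Bad ω ∧ output x ω = a).card := by
      rw [← card_filter_add_card_filter_not (fun ω : Coins p => Good p N κ (itemTarget hN ω.targets)),
        filter_filter, filter_filter]
      simp only [and_comm, Bad]
    rw [h1, Nat.cast_add, add_div]
    refine add_le_add_left ?_ _
    by_cases h : ∃ π : Equiv.Perm (Fin N), a = some fun i => some (π i)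
    · obtain ⟨π, rfl⟩ := h
      rw [div_le_iff₀ hC]
      refine (card_good_output_le hB hN x π κ).trans ?_
      rw [div_mul_eq_mul_div, Fintype.card_perm, Fintype.card_fin]
      refine div_le_div_of_nonneg_right (le_mul_of_one_le_left hC.le ?_) (Nat.cast_nonneg _)
      rw [Nat.one_le_cast, Nat.one_le_iff_ne_zero, ← Nat.pos_iff_ne_zero, card_pos]
      exact ⟨π, by simp⟩
    -- Good targets never produce the failure symbol or an array that is not an arrangement.
    · have : (univ.filter fun ω : Coins p => Good p N κ (itemTarget hN ω.targets) ∧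
          output x ω = a) = ∅ := by
        rw [filter_eq_empty_iff]
        rintro ω - ⟨hg, rfl⟩
        exact h (exists_perm_of_good hN x ω hg)
      rw [this, card_empty, Nat.cast_zero, zero_div]
      positivity
  · dsimp only [e]
    rw [← sum_div, ← Nat.cast_sum]
    have h1 : ∑ a, (univ.filter fun ω : Coins p => Bad ω ∧ output x ω = a).card =
        (univ.filter Bad).card := by
      rw [card_eq_sum_card_fiberwise (f := output x) (t := univ) (fun _ _ => mem_coe.2 (mem_univ _))]
      simp only [filter_filter]
    rw [h1, card_filter_coins]
    have h2 : ∀ T : Fin p.B → Fin p.D → Fin p.B,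
        ((univ.filter fun s : Fin p.B → Equiv.Perm (Fin p.midSize) => Bad ⟨T, s⟩).card : ℝ) =
        (p.midSize.factorial : ℝ) ^ p.B *
          (fun v => if Good p N κ v then (0 : ℝ) else 1) (itemTarget hN T) := by
      intro T
      dsimp only [Bad]
      by_cases h : Good p N κ (itemTarget hN T)
      · simp [h]
      · simp [h, Fintype.card_perm]
    rw [Nat.cast_sum, sum_congr rfl fun T _ => h2 T, ← mul_sum, card_coins]
    have h3 := sum_itemTarget hN fun v => if Good p N κ v then (0 : ℝ) else 1
    have h4 : ∑ v : Fin N → Fin p.B, (if Good p N κ v then (0 : ℝ) else 1) =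
        ((univ.filter fun v : Fin N → Fin p.B => ¬ Good p N κ v).card : ℝ) := by
      rw [card_filter, Nat.cast_sum]
      refine sum_congr rfl fun v _ => ?_
      by_cases h : Good p N κ v <;> simp [h]
    rw [h4] at h3
    rw [div_eq_div_iff (by positivity) (by positivity), mul_assoc, h3]
    ring

end Distance

/-! ### Chernoff bounds for the bad events -/

section Concentration

open Finset

variable {p : Params} {N : ℕ}

theorem exp_sub_one_le {θ : ℝ} (h0 : 0 ≤ θ) (h1 : θ ≤ 1) : Real.exp θ - 1 ≤ θ + θ ^ 2 := by
  have := Real.abs_exp_sub_one_sub_id_le (x := θ) (by rw [abs_of_nonneg h0]; exact h1)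
  have := (abs_le.1 this).2
  linarith

/-- Chernoff bound for the number of items in `A` with target in `J`. -/
theorem card_count_ge_le {B : ℕ} (hB : 0 < B) (A : Finset (Fin N)) (J : Finset (Fin B)) {θ : ℝ}
    (h0 : 0 ≤ θ) (h1 : θ ≤ 1) (c : ℝ) :
    ((univ.filter fun v : Fin N → Fin B => c ≤ ((A.filter fun k => v k ∈ J).card : ℝ)).card : ℝ) ≤
      (B : ℝ) ^ N * Real.exp (A.card * (J.card / B) * (θ + θ ^ 2) - θ * c) := by
  have hB' : (0 : ℝ) < B := Nat.cast_pos.2 hB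
  -- Independence of the targets: the exponential moment factorises over the items.
  have e1 : ∑ v : Fin N → Fin B, Real.exp (θ * ((A.filter fun k => v k ∈ J).card : ℝ)) =
      ∏ k : Fin N, ∑ j : Fin B, if k ∈ A ∧ j ∈ J then Real.exp θ else 1 := by
    rw [Fintype.prod_sum]
    refine sum_congr rfl fun v _ => ?_
    rw [← prod_filter, prod_const, ← Real.exp_nat_mul, mul_comm]
    congr 4
    ext k
    simp
  have e2 : ∀ k : Fin N, (∑ j : Fin B, if k ∈ A ∧ j ∈ J then Real.exp θ else 1) =
      B * if k ∈ A then 1 + (J.card / B) * (Real.exp θ - 1) else 1 := by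
    intro k
    by_cases hk : k ∈ A
    · have : ∀ j : Fin B, (if k ∈ A ∧ j ∈ J then Real.exp θ else 1) =
          1 + if j ∈ J then Real.exp θ - 1 else 0 := fun j => by
        by_cases hj : j ∈ J <;> simp [hk, hj]
      rw [sum_congr rfl fun j _ => this j, sum_add_distrib, if_pos hk, ← sum_filter]
      simp only [sum_const, card_univ, Fintype.card_fin, nsmul_eq_mul, mul_one]
      rw [filter_mem_eq_inter, univ_inter]
      field_simp
    · simp [hk]
  have hq : 0 ≤ (J.card : ℝ) / B := by positivity
  have e3 : ∑ v : Fin N → Fin B, Real.exp (θ * ((A.filter fun k => v k ∈ J).card : ℝ)) ≤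
      (B : ℝ) ^ N * Real.exp (A.card * (J.card / B) * (θ + θ ^ 2)) := by
    rw [e1, prod_congr rfl fun k _ => e2 k, prod_mul_distrib, prod_const, card_univ,
      Fintype.card_fin, ← prod_filter, filter_mem_eq_inter, univ_inter, prod_const]
    refine mul_le_mul_of_nonneg_left ?_ (by positivity)
    have h2 : 1 + (J.card / B) * (Real.exp θ - 1) ≤ Real.exp ((J.card / B) * (θ + θ ^ 2)) := by
      have h3 := Real.add_one_le_exp ((J.card : ℝ) / B * (θ + θ ^ 2))
      have h4 := mul_le_mul_of_nonneg_left (exp_sub_one_le h0 h1) hq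
      linarith
    have h5 : 0 ≤ 1 + ((J.card : ℝ) / B) * (Real.exp θ - 1) := by
      have := mul_nonneg hq (sub_nonneg.2 (Real.one_le_exp h0))
      linarith
    refine (pow_le_pow_left₀ h5 h2 _).trans (le_of_eq ?_)
    rw [← Real.exp_nat_mul]
    ring_nf
  rw [sub_eq_add_neg, Real.exp_add, ← mul_assoc]
  refine le_trans ?_ (mul_le_mul_of_nonneg_right e3 (Real.exp_pos _).le)
  -- Markov's inequality, termwise: the indicator of the event is at most `exp (θ * (count - c))`.
  rw [sum_mul, card_filter, Nat.cast_sum]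
  refine sum_le_sum fun v _ => ?_
  rw [← Real.exp_add]
  split_ifs with h
  · rw [Nat.cast_one]
    refine Real.one_le_exp ?_
    have := mul_le_mul_of_nonneg_left h h0
    linarith
  · rw [Nat.cast_zero]
    exact (Real.exp_pos _).le

/-- Deterministic conditions under which bad targets are unlikely. -/
structure Admits (p : Params) (N κ : ℕ) (θ θ' δ : ℝ) : Prop where
  W : p.W = 2
  two_le : 2 ≤ p.B
  le_D : (N : ℝ) / p.B ≤ p.D
  D_le : (p.D : ℝ) ≤ N / p.B + 1
  θ0 : 0 ≤ θ
  θ1 : θ ≤ 1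
  C : (p.D : ℝ) / p.B * (1 + θ) ≤ p.C
  S : p.B * κ < p.S
  K : κ ≤ p.K
  θ'0 : 0 ≤ θ'
  θ'1 : θ' ≤ 1
  Q : δ ≤ p.Q
  δ : δ ≤ N / p.B - p.B

-- Condition `C` of `Admits` makes the mean term `|A| / B * (θ + θ²)` at most `θ * (b + 1 - a) * C`.
-- The allowance of `C` per bucket thus absorbs it whatever the length of the run, and only `-θ * κ`
-- remains.
open Classical in
theorem card_stash_bad_le {κ : ℕ} {θ θ' δ : ℝ} (h : Admits p N κ θ θ' δ) (j : Fin p.B) (a b : ℕ) :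
    ((univ.filter fun v : Fin N → Fin p.B =>
      (b + 1 - a) * p.C + κ < cnt v j (a * p.D) ((b + 1) * p.D)).card : ℝ) ≤
      (p.B : ℝ) ^ N * Real.exp (-(θ * κ)) := by
  have hB : 0 < p.B := by have := h.two_le; omega
  have hB' : (0 : ℝ) < p.B := Nat.cast_pos.2 hB
  let A := univ.filter fun k : Fin N => a * p.D ≤ k.val ∧ k.val < (b + 1) * p.D
  have hA : (A.card : ℝ) ≤ ((b + 1 - a : ℕ) : ℝ) * p.D := by
    rw [← Nat.cast_mul, Nat.cast_le, Nat.sub_mul, ← Nat.card_Ico]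
    refine card_le_card_of_injOn Fin.val (fun k hk => ?_) Fin.val_injective.injOn
    simpa [A] using hk
  have hθ := h.θ0
  refine le_trans ?_ ((card_count_ge_le hB A {j} h.θ0 h.θ1
    (((b + 1 - a : ℕ) : ℝ) * p.C + κ)).trans ?_)
  · refine Nat.cast_le.2 (card_le_card fun v hv => ?_)
    rw [mem_filter] at hv ⊢
    refine ⟨mem_univ _, ?_⟩
    have e : A.filter (fun k => v k ∈ ({j} : Finset (Fin p.B))) =
        univ.filter fun k : Fin N => v k = j ∧ a * p.D ≤ k.val ∧ k.val < (b + 1) * p.D := by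
      ext k
      simp [A, and_comm]
    rw [e]
    have := hv.2.le
    unfold cnt at this
    exact_mod_cast this
  · refine mul_le_mul_of_nonneg_left (Real.exp_le_exp.2 ?_) (by positivity)
    rw [card_singleton, Nat.cast_one]
    have h1 : (A.card : ℝ) * (1 / p.B) * (θ + θ ^ 2) ≤
        θ * (((b + 1 - a : ℕ) : ℝ) * ((p.D : ℝ) / p.B * (1 + θ))) := by
      have h2 : 0 ≤ (1 / (p.B : ℝ)) * (θ + θ ^ 2) := by positivity
      calc _ = (A.card : ℝ) * ((1 / p.B) * (θ + θ ^ 2)) := by ring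
        _ ≤ (((b + 1 - a : ℕ) : ℝ) * p.D) * ((1 / p.B) * (θ + θ ^ 2)) :=
          mul_le_mul_of_nonneg_right hA h2
        _ = _ := by ring
    have h3 : θ * (((b + 1 - a : ℕ) : ℝ) * ((p.D : ℝ) / p.B * (1 + θ))) ≤
        θ * (((b + 1 - a : ℕ) : ℝ) * p.C) :=
      mul_le_mul_of_nonneg_left (mul_le_mul_of_nonneg_left h.C (Nat.cast_nonneg _)) h.θ0
    linarith

-- The mean number of items with target at most `b` is at most `(b + 1) * D`, so the slack `Q ≥ δ`
-- is pure deviation. The quadratic term is bounded by that of all `N` items.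
open Classical in
theorem card_overflow_le {κ : ℕ} {θ θ' δ : ℝ} (h : Admits p N κ θ θ' δ) (b : ℕ) (hb : b < p.B) :
    ((univ.filter fun v : Fin N → Fin p.B =>
      (b + 1) * p.D + p.Q < (univ.filter fun k => (v k).val < b + 1).card).card : ℝ) ≤
      (p.B : ℝ) ^ N * Real.exp (N * θ' ^ 2 - θ' * δ) := by
  have hB : 0 < p.B := by have := h.two_le; omega
  have hB' : (0 : ℝ) < p.B := Nat.cast_pos.2 hB
  let J := univ.filter fun j : Fin p.B => j.val < b + 1
  have hJ : (J.card : ℝ) ≤ b + 1 := by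
    have : J.card ≤ (range (b + 1)).card :=
      card_le_card_of_injOn Fin.val (fun k hk => by simpa [J] using hk) Fin.val_injective.injOn
    rw [card_range] at this
    exact_mod_cast this
  have hJ1 : (J.card : ℝ) / p.B ≤ 1 := by
    rw [div_le_one hB']
    refine hJ.trans ?_
    exact_mod_cast hb
  refine le_trans ?_ ((card_count_ge_le (N := N) hB univ J h.θ'0 h.θ'1 ((b + 1) * p.D + p.Q)).trans ?_)
  · refine Nat.cast_le.2 (card_le_card fun v hv => ?_)
    rw [mem_filter] at hv ⊢
    refine ⟨mem_univ _, ?_⟩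
    have := hv.2.le
    simp only [J, mem_filter, mem_univ, true_and]
    exact_mod_cast this
  · refine mul_le_mul_of_nonneg_left (Real.exp_le_exp.2 ?_) (by positivity)
    rw [card_univ, Fintype.card_fin]
    have hN : (0 : ℝ) ≤ N := Nat.cast_nonneg _
    have h1 : (N : ℝ) * (J.card / p.B) ≤ (b + 1) * p.D := by
      calc (N : ℝ) * (J.card / p.B) = J.card * (N / p.B) := by ring
        _ ≤ (b + 1) * p.D := mul_le_mul hJ h.le_D (by positivity) (by positivity)
    have h2 : (N : ℝ) * (J.card / p.B) * θ' ^ 2 ≤ N * θ' ^ 2 :=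
      mul_le_mul_of_nonneg_right (mul_le_of_le_one_right hN hJ1) (by positivity)
    have h3 := mul_le_mul_of_nonneg_right h1 h.θ'0
    have h4 := mul_le_mul_of_nonneg_left h.Q h.θ'0
    nlinarith

-- Few items below `b` means many items at or above `b`, so the upper-tail bound applies to the
-- complement. The lag of one bucket gives room `b * (N / B) - (b - 1) * D ≥ N / B - B ≥ δ`, where
-- the loss up to `B` comes from the rounding in `D ≤ N / B + 1`.
open Classical in
theorem card_underflow_le {κ : ℕ} {θ θ' δ : ℝ} (h : Admits p N κ θ θ' δ) (b : ℕ) (hb : b < p.B)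
    (hb1 : 1 ≤ b) :
    ((univ.filter fun v : Fin N → Fin p.B =>
      (univ.filter fun k => (v k).val < b).card < (b - 1) * p.D).card : ℝ) ≤
      (p.B : ℝ) ^ N * Real.exp (N * θ' ^ 2 - θ' * δ) := by
  have hB : 0 < p.B := by have := h.two_le; omega
  have hB' : (0 : ℝ) < p.B := Nat.cast_pos.2 hB
  let J := univ.filter fun j : Fin p.B => ¬ j.val < b
  have hJ : (J.card : ℝ) ≤ p.B - b := by
    have : J.card ≤ (Ico b p.B).card :=
      card_le_card_of_injOn Fin.val (fun k hk => by simpa [J] using hk) Fin.val_injective.injOn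
    rw [Nat.card_Ico] at this
    rw [← Nat.cast_sub hb.le]
    exact_mod_cast this
  have hb0 : (1 : ℝ) ≤ b := by exact_mod_cast hb1
  have hbB : (b : ℝ) ≤ p.B := by exact_mod_cast hb.le
  have hJ1 : (J.card : ℝ) / p.B ≤ 1 := by
    rw [div_le_one hB']
    linarith
  refine le_trans ?_ ((card_count_ge_le (N := N) hB univ J h.θ'0 h.θ'1 (N - (b - 1) * p.D)).trans ?_)
  · refine Nat.cast_le.2 (card_le_card fun v hv => ?_)
    rw [mem_filter] at hv ⊢
    refine ⟨mem_univ _, ?_⟩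
    have h1 := card_filter_add_card_filter_not (s := (univ : Finset (Fin N)))
      (fun k => (v k).val < b)
    rw [card_univ, Fintype.card_fin] at h1
    have h2 : ((univ.filter fun k => (v k).val < b).card : ℝ) +
        ((univ.filter fun k => ¬ (v k).val < b).card : ℝ) = N := by exact_mod_cast h1
    have h3 : ((univ.filter fun k => (v k).val < b).card : ℝ) < ((b - 1 : ℕ) : ℝ) * p.D := by
      exact_mod_cast hv.2
    rw [Nat.cast_sub hb1, Nat.cast_one] at h3
    simp only [J, mem_filter, mem_univ, true_and]
    linarith
  · refine mul_le_mul_of_nonneg_left (Real.exp_le_exp.2 ?_) (by positivity)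
    rw [card_univ, Fintype.card_fin]
    have hN : (0 : ℝ) ≤ N := Nat.cast_nonneg _
    have h0 : (0 : ℝ) ≤ N / p.B := by positivity
    have h1 : (N : ℝ) * (J.card / p.B) ≤ N - b * (N / p.B) := by
      calc (N : ℝ) * (J.card / p.B) = J.card * (N / p.B) := by ring
        _ ≤ (p.B - b) * (N / p.B) := mul_le_mul_of_nonneg_right hJ h0
        _ = _ := by field_simp
    have h2 : (N : ℝ) * (J.card / p.B) * θ' ^ 2 ≤ N * θ' ^ 2 :=
      mul_le_mul_of_nonneg_right (mul_le_of_le_one_right hN hJ1) (by positivity)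
    have h3 := mul_le_mul_of_nonneg_right h1 h.θ'0
    have h4 : ((b : ℝ) - 1) * p.D ≤ (b - 1) * (N / p.B + 1) :=
      mul_le_mul_of_nonneg_left h.D_le (by linarith)
    have h5 : (b : ℝ) * (N / p.B) - (b - 1) * p.D ≥ δ := by
      have := h.δ
      linarith
    have h6 := mul_le_mul_of_nonneg_left h5 h.θ'0
    linarith

open Classical in
/-- Bad targets are unlikely. -/
theorem card_bad_le {κ : ℕ} {θ θ' δ : ℝ} (h : Admits p N κ θ θ' δ) :
    ((univ.filter fun v : Fin N → Fin p.B => ¬ Good p N κ v).card : ℝ) / (p.B : ℝ) ^ N ≤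
      (p.B : ℝ) ^ 3 * Real.exp (-(θ * κ)) +
        2 * p.B * Real.exp (N * θ' ^ 2 - θ' * δ) := by
  have hB : 0 < p.B := by have := h.two_le; omega
  have hBN : (0 : ℝ) < (p.B : ℝ) ^ N := by positivity
  rw [div_le_iff₀ hBN]
  -- Union bound: at most `B ^ 3` stash events (target and interval), `B` overflows and `B`
  -- underflows.
  let I₁ := (univ : Finset (Fin p.B × Fin p.B × Fin p.B)).filter fun t => t.2.1 ≤ t.2.2
  let I₂ := (univ : Finset (Fin p.B)).filter fun b => 1 ≤ b.val
  let E₁ : Fin p.B × Fin p.B × Fin p.B → Finset (Fin N → Fin p.B) := fun t =>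
    univ.filter fun v => (t.2.2.val + 1 - t.2.1.val) * p.C + κ <
      cnt v t.1 (t.2.1 * p.D) ((t.2.2 + 1) * p.D)
  let E₂ : Fin p.B → Finset (Fin N → Fin p.B) := fun b => univ.filter fun v =>
    (b.val + 1) * p.D + p.Q < (univ.filter fun k => (v k).val < b.val + 1).card
  let E₃ : Fin p.B → Finset (Fin N → Fin p.B) := fun b => univ.filter fun v =>
    (univ.filter fun k => (v k).val < b.val).card < (b.val - 1) * p.D
  have hsub : (univ.filter fun v : Fin N → Fin p.B => ¬ Good p N κ v) ⊆
      I₁.biUnion E₁ ∪ (univ.biUnion E₂ ∪ I₂.biUnion E₃) := by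
    intro v hv
    rw [mem_filter] at hv
    by_contra hn
    simp only [mem_union, not_or, mem_biUnion, not_exists, not_and] at hn
    obtain ⟨n1, n2, n3⟩ := hn
    refine hv.2 ⟨⟨fun j a b hab hb => ?_, h.S, h.K⟩, ⟨fun b hb => ?_, fun b hb hb' => ?_⟩⟩
    · have := n1 (j, ⟨a, by omega⟩, ⟨b, hb⟩) (by simp [I₁, hab])
      simp only [E₁, mem_filter, mem_univ, true_and, not_lt] at this
      exact this
    · have := n2 ⟨b, hb⟩ (mem_univ _)
      simp only [E₂, mem_filter, mem_univ, true_and, not_lt] at this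
      rw [h.W, min_eq_left h.two_le]
      -- This settles the case in which the minimum in `le_cap` is `N`; otherwise the window of `2 *
      -- D` makes up for the two buckets not yet drained.
      have hN := card_le_univ (univ.filter fun k : Fin N => (v k).val < b + 1)
      rw [Fintype.card_fin] at hN
      have e : (b + 1) * p.D ≤ (b + 1 - 2) * p.D + 2 * p.D := by
        rw [← add_mul]
        exact Nat.mul_le_mul_right _ (by omega)
      omega
    · rw [h.W, min_eq_left h.two_le] at hb ⊢
      have := n3 ⟨b, hb'⟩ (by simp [I₂]; omega)
      simp only [E₃, mem_filter, mem_univ, true_and, not_lt] at this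
      rw [show b + 1 - 2 = b - 1 by omega]
      exact (min_le_left _ _).trans this
  have hcard := (card_le_card hsub).trans ((card_union_le _ _).trans
    (Nat.add_le_add_left (card_union_le _ _) _))
  have hcard' : ((univ.filter fun v : Fin N → Fin p.B => ¬ Good p N κ v).card : ℝ) ≤
      ((I₁.biUnion E₁).card : ℝ) + (((univ.biUnion E₂).card : ℝ) + ((I₂.biUnion E₃).card : ℝ)) := by
    exact_mod_cast hcard
  have hI : ∀ {ι : Type} (I : Finset ι) (E : ι → Finset (Fin N → Fin p.B)) (n : ℕ) (y : ℝ),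
      0 ≤ y → I.card ≤ n → (∀ i ∈ I, ((E i).card : ℝ) ≤ (p.B : ℝ) ^ N * y) →
      ((I.biUnion E).card : ℝ) ≤ n * y * (p.B : ℝ) ^ N := by
    intro ι I E n y hy hn hE
    calc ((I.biUnion E).card : ℝ) ≤ ((∑ i ∈ I, (E i).card : ℕ) : ℝ) :=
          Nat.cast_le.2 card_biUnion_le
      _ = ∑ i ∈ I, ((E i).card : ℝ) := Nat.cast_sum _ _
      _ ≤ ∑ i ∈ I, (p.B : ℝ) ^ N * y := sum_le_sum hE
      _ = I.card * ((p.B : ℝ) ^ N * y) := by rw [sum_const, nsmul_eq_mul]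
      _ ≤ n * ((p.B : ℝ) ^ N * y) :=
          mul_le_mul_of_nonneg_right (Nat.cast_le.2 hn) (by positivity)
      _ = _ := by ring
  have b1 := hI I₁ E₁ (p.B ^ 3) (Real.exp (-(θ * κ))) (Real.exp_pos _).le
    ((card_le_univ _).trans (by simp [pow_succ, mul_assoc])) fun t _ =>
      card_stash_bad_le h t.1 t.2.1 t.2.2
  have b2 := hI univ E₂ p.B (Real.exp (N * θ' ^ 2 - θ' * δ)) (Real.exp_pos _).le
    (by simp) fun b _ => card_overflow_le h b b.2
  have b3 := hI I₂ E₃ p.B (Real.exp (N * θ' ^ 2 - θ' * δ)) (Real.exp_pos _).le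
    ((card_le_univ _).trans (by simp)) fun b hb =>
      card_underflow_le h b b.2 (by simpa [I₂] using hb)
  push_cast at b1
  linarith

end Concentration

/-! ### Choice of the free constants and asymptotics -/

section Asymptotics

/-- What is needed of `N` and `ε` for the estimates. -/
structure Large (N : ℕ) (ε : ℝ) : Prop where
  log : 60 ≤ Real.log N
  pos : 0 < ε
  small : ε ≤ 1 / 10
  log_le : Real.log N ≤ (N : ℝ) ^ ε
  one_le : 1 ≤ ε * (N : ℝ) ^ ε

variable {N : ℕ} {ε : ℝ}

theorem Large.sixty_le_N (h : Large N ε) : (60 : ℝ) ≤ N :=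
  h.log.trans (Real.log_le_self (Nat.cast_nonneg _))

/-- With X = N^ε, Y = N^(1/2-ε) and R = N^(1/2), all parameters become monomials up to rounding, so
the later estimates are polynomial. -/
theorem Large.powers (h : Large N ε) : ∃ X Y R : ℝ, (N : ℝ) ^ ε = X ∧ 60 ≤ X ∧ X ≤ R ∧ X ^ 2 ≤ Y ∧
    R = Y * X ∧ (N : ℝ) = R ^ 2 ∧ (N : ℝ) ^ (1 / 2 - ε) = Y ∧ (N : ℝ) ^ (2 * ε) = X ^ 2 ∧
    (N : ℝ) ^ (3 * ε) = X ^ 3 ∧ (N : ℝ) ^ (1 / 2 + 2 * ε) = R * X ^ 2 ∧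
    (N : ℝ) ^ (1 / 2 + ε) = R * X ∧ (N : ℝ) ^ (1 / 2 + 3 * ε) = R * X ^ 3 := by
  have hN := h.sixty_le_N
  have hN0 : (0 : ℝ) < N := by linarith
  have hpow : ∀ n : ℕ, (N : ℝ) ^ ((n : ℝ) * ε) = ((N : ℝ) ^ ε) ^ n := fun n => by
    rw [mul_comm, Real.rpow_mul hN0.le, Real.rpow_natCast]
  have h2 := hpow 2
  have h3 := hpow 3
  push_cast at h2 h3
  have hs := h.small
  refine ⟨(N : ℝ) ^ ε, (N : ℝ) ^ (1 / 2 - ε), (N : ℝ) ^ (1 / 2 : ℝ), rfl, h.log.trans h.log_le,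
    ?_, ?_, ?_, ?_, rfl, h2, h3, ?_, ?_, ?_⟩
  · exact Real.rpow_le_rpow_of_exponent_le (by linarith) (by linarith)
  · rw [← h2]
    exact Real.rpow_le_rpow_of_exponent_le (by linarith) (by linarith)
  · rw [← Real.rpow_add hN0]
    congr 1
    ring
  · rw [← Real.rpow_natCast, ← Real.rpow_mul hN0.le]
    norm_num
  · rw [Real.rpow_add hN0, h2]
  · rw [Real.rpow_add hN0]
  · rw [Real.rpow_add hN0, h3]

/-- `κ` is half of N^(3ε) so that `B * κ < S` survives rounding, using `B < 2 * Y`. Taking `θ = ε /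
2` leaves the other half of the margin in `C` for the rounding of `D`. `δ` is a quarter of
N^(1/2+ε), since `N / B` is at least half of it and `B` is much smaller; `θ'` is `δ / (2 * N)`, the
minimiser of `N * θ' ^ 2 - θ' * δ`. -/
theorem Large.admits (h : Large N ε) :
    Admits (params N ε) N ⌊((N : ℝ) ^ ε) ^ 3 / 2⌋₊ (ε / 2) ((N : ℝ) ^ (1 / 2 + ε) / (8 * N))
      ((N : ℝ) ^ (1 / 2 + ε) / 4) := by
  have hone := h.one_le
  have hpos := h.pos
  have hs := h.small
  obtain ⟨X, Y, R, eX, hX, hXR, hXY, eR, eN, eY, e2, e3, e22, e1, -⟩ := h.powers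
  rw [eX] at hone ⊢
  rw [e1]
  have hX0 : 0 < X := by linarith
  have hY1 : 3600 ≤ Y := by nlinarith
  have hY0 : 0 < Y := by linarith
  have hR0 : 0 < R := by linarith
  have hN0 : (0 : ℝ) < N := by rw [eN]; positivity
  have hBl : Y ≤ ((params N ε).B : ℝ) := by
    rw [← eY]; exact Nat.le_ceil _
  have hBu : ((params N ε).B : ℝ) < Y + 1 := by
    rw [← eY]; exact Nat.ceil_lt_add_one (by positivity)
  have hB0 : (0 : ℝ) < (params N ε).B := by linarith
  have hNB : (N : ℝ) / (params N ε).B ≤ R * X := by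
    rw [div_le_iff₀ hB0, eN]
    calc R ^ 2 = R * X * Y := by rw [eR]; ring
      _ ≤ _ := mul_le_mul_of_nonneg_left hBl (by positivity)
  have hNB' : R * X / 2 ≤ (N : ℝ) / (params N ε).B := by
    rw [le_div_iff₀ hB0, eN]
    calc R * X / 2 * (params N ε).B ≤ R * X / 2 * (2 * Y) :=
          mul_le_mul_of_nonneg_left (by linarith) (by positivity)
      _ = R ^ 2 := by rw [eR]; ring
  have hDu : ((params N ε).D : ℝ) ≤ N / (params N ε).B + 1 :=
    (Nat.ceil_lt_add_one (by positivity)).le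
  have hεX : 60 ≤ ε * X ^ 2 := by nlinarith
  refine ⟨rfl, ?_, Nat.le_ceil _, hDu, by linarith, by linarith, ?_, ?_, ?_, by positivity, ?_,
    ?_, ?_⟩
  · have : (2 : ℝ) ≤ (params N ε).B := by linarith
    exact_mod_cast this
  · have hC : (1 + ε) * X ^ 2 ≤ ((params N ε).C : ℝ) := by
      rw [← e2]; exact Nat.le_ceil _
    refine le_trans ?_ hC
    have h1 : ((params N ε).D : ℝ) / (params N ε).B ≤ X ^ 2 + 1 := by
      rw [div_le_iff₀ hB0]
      have : (X ^ 2 + 1) * Y ≤ (X ^ 2 + 1) * (params N ε).B :=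
        mul_le_mul_of_nonneg_left hBl (by positivity)
      have e : R * X = X ^ 2 * Y := by rw [eR]; ring
      linarith
    have h2 := mul_le_mul_of_nonneg_right h1 (show 0 ≤ 1 + ε / 2 by linarith)
    nlinarith
  · have hS : R * X ^ 2 ≤ ((params N ε).S : ℝ) := by
      rw [← e22]; exact Nat.le_ceil _
    have hk : (⌊X ^ 3 / 2⌋₊ : ℝ) ≤ X ^ 3 / 2 := Nat.floor_le (by positivity)
    have : ((params N ε).B : ℝ) * (⌊X ^ 3 / 2⌋₊ : ℝ) < (params N ε).S := by
      calc ((params N ε).B : ℝ) * (⌊X ^ 3 / 2⌋₊ : ℝ) ≤ (params N ε).B * (X ^ 3 / 2) :=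
            mul_le_mul_of_nonneg_left hk hB0.le
        _ < (2 * Y) * (X ^ 3 / 2) :=
            mul_lt_mul_of_pos_right (by linarith) (by positivity)
        _ = R * X ^ 2 := by rw [eR]; ring
        _ ≤ _ := hS
    exact_mod_cast this
  · have : (⌊X ^ 3 / 2⌋₊ : ℝ) ≤ (params N ε).K := by
      calc (⌊X ^ 3 / 2⌋₊ : ℝ) ≤ X ^ 3 / 2 := Nat.floor_le (by positivity)
        _ ≤ X ^ 3 := by have : 0 < X ^ 3 := by positivity
                        linarith
        _ ≤ _ := by rw [← e3]; exact Nat.le_ceil _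
    exact_mod_cast this
  · rw [div_le_one (by positivity), eN]
    nlinarith
  · have hQ : R * X ≤ ((params N ε).Q : ℝ) := by
      rw [← e1]; exact Nat.le_ceil _
    have : 0 < R * X := by positivity
    linarith
  · have : R * X = Y * X ^ 2 := by rw [eR]; ring
    nlinarith

theorem Large.le_mul (h : Large N ε) : N ≤ (params N ε).B * (params N ε).D := by
  have ha := h.admits
  have hB0 : (0 : ℝ) < (params N ε).B := by have := ha.two_le; exact_mod_cast (by omega)
  have := ha.le_D
  rw [div_le_iff₀ hB0] at this
  rw [mul_comm]
  exact_mod_cast this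

/-- All exponents are at most `-X ^ 2 / 64`, the union bound costs at most `N ^ 4`, and `X ≥ log N`
makes the result superpolynomially small. -/
theorem Large.statDist_le (h : Large N ε) (x : Equiv.Perm (Fin N)) :
    statDist (outputLaw (params N ε) x) (uniformLaw N) ≤
      (N : ℝ) ^ (-(Real.log N / 64 - 4)) := by
  have ha := h.admits
  have hB2 := ha.two_le
  refine (statDist_outputLaw_le (by omega) h.le_mul _ x).trans ((card_bad_le ha).trans ?_)
  have hone := h.one_le
  have hpos := h.pos
  have hs := h.small
  have hlog := h.log_le
  have h60 := h.log
  obtain ⟨X, Y, R, eX, hX, hXR, hXY, eR, eN, eY, e2, e3, e22, e1, -⟩ := h.powers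
  rw [eX] at hone hlog ⊢
  rw [e1]
  have hX0 : 0 < X := by linarith
  have hY1 : 3600 ≤ Y := by nlinarith
  have hR0 : 0 < R := by linarith
  have hN0 : (0 : ℝ) < N := by rw [eN]; positivity
  have hBu : ((params N ε).B : ℝ) < Y + 1 := by
    rw [← eY]; exact Nat.ceil_lt_add_one (by positivity)
  have hN60 := h.sixty_le_N
  have hBN : ((params N ε).B : ℝ) ≤ N := by
    have : Y + 1 ≤ R := by rw [eR]; nlinarith
    rw [eN]
    nlinarith
  have hk : X ^ 3 / 2 - 1 < (⌊X ^ 3 / 2⌋₊ : ℝ) := by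
    have := Nat.lt_floor_add_one (X ^ 3 / 2)
    linarith
  -- From `1 ≤ ε * X`: the factor `ε` in `θ` costs at most one power of `X`, which is why `κ` is of
  -- order X³.
  have hεX : X ^ 2 ≤ ε * X ^ 3 := by nlinarith [sq_nonneg X]
  have x1 : -(ε / 2 * (⌊X ^ 3 / 2⌋₊ : ℝ)) ≤ -(X ^ 2 / 64) := by
    have := mul_le_mul_of_nonneg_left hk.le (show 0 ≤ ε / 2 by linarith)
    nlinarith
  have x2 : (N : ℝ) * (R * X / (8 * N)) ^ 2 - R * X / (8 * N) * (R * X / 4) = -(X ^ 2 / 64) := by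
    rw [eN]
    field_simp
    ring
  rw [x2]
  have y1 : Real.exp (-(ε / 2 * (⌊X ^ 3 / 2⌋₊ : ℝ))) ≤ Real.exp (-(X ^ 2 / 64)) :=
    Real.exp_le_exp.2 x1
  have hE : 0 < Real.exp (-(X ^ 2 / 64)) := Real.exp_pos _
  have hB0 : (0 : ℝ) ≤ (params N ε).B := Nat.cast_nonneg _
  have hB3 : ((params N ε).B : ℝ) ^ 3 ≤ (N : ℝ) ^ 3 := pow_le_pow_left₀ hB0 hBN 3
  calc ((params N ε).B : ℝ) ^ 3 * Real.exp (-(ε / 2 * (⌊X ^ 3 / 2⌋₊ : ℝ))) +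
        2 * (params N ε).B * Real.exp (-(X ^ 2 / 64))
      ≤ (N : ℝ) ^ 3 * Real.exp (-(X ^ 2 / 64)) + 2 * N * Real.exp (-(X ^ 2 / 64)) :=
        add_le_add (mul_le_mul hB3 y1 (Real.exp_pos _).le (by positivity))
          (mul_le_mul_of_nonneg_right (by linarith) hE.le)
    _ = ((N : ℝ) ^ 3 + 2 * N) * Real.exp (-(X ^ 2 / 64)) := by ring
    _ ≤ (N : ℝ) ^ 4 * Real.exp (-(X ^ 2 / 64)) := by
        refine mul_le_mul_of_nonneg_right ?_ hE.le
        have n2 : (N : ℝ) ≤ (N : ℝ) ^ 3 := le_self_pow₀ (by linarith) (by norm_num)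
        have n3 : (0 : ℝ) ≤ (N : ℝ) ^ 3 := by positivity
        nlinarith
    _ = Real.exp (Real.log N * 4 - X ^ 2 / 64) := by
        have e4 : Real.exp (Real.log N * 4) = (N : ℝ) ^ 4 := by
          rw [mul_comm, ← Real.exp_log (pow_pos hN0 4), Real.log_pow, Nat.cast_ofNat]
        rw [sub_eq_add_neg, Real.exp_add, e4]
    _ ≤ Real.exp (Real.log N * (-(Real.log N / 64 - 4))) := by
        refine Real.exp_le_exp.2 ?_
        have : Real.log N ^ 2 ≤ X ^ 2 := pow_le_pow_left₀ (by linarith) hlog 2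
        linarith
    _ = (N : ℝ) ^ (-(Real.log N / 64 - 4)) := (Real.rpow_def_of_pos hN0 _).symm

/-- Every term is O(R X²), with constants adding up to less than 60. The extra factor `X ≥ 60`
absorbs them. -/
theorem Large.memBound_le (h : Large N ε) :
    (memBound (params N ε) : ℝ) ≤ (N : ℝ) ^ (1 / 2 + 3 * ε) := by
  have ha := h.admits
  have hpos := h.pos
  have hs := h.small
  have hDu := ha.D_le
  obtain ⟨X, Y, R, eX, hX, hXR, hXY, eR, eN, eY, e2, e3, e22, e1, e33⟩ := h.powers
  rw [e33]
  have hX0 : 0 < X := by linarith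
  have hY1 : 3600 ≤ Y := by nlinarith
  have hR0 : 0 < R := by linarith
  have hBl : Y ≤ ((params N ε).B : ℝ) := by
    rw [← eY]; exact Nat.le_ceil _
  have hBu : ((params N ε).B : ℝ) < Y + 1 := by
    rw [← eY]; exact Nat.ceil_lt_add_one (by positivity)
  have hCu : ((params N ε).C : ℝ) < (1 + ε) * X ^ 2 + 1 := by
    rw [← e2]; exact Nat.ceil_lt_add_one (by positivity)
  have hKu : ((params N ε).K : ℝ) < X ^ 3 + 1 := by
    rw [← e3]; exact Nat.ceil_lt_add_one (by positivity)
  have hSu : ((params N ε).S : ℝ) < R * X ^ 2 + 1 := by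
    rw [← e22]; exact Nat.ceil_lt_add_one (by positivity)
  have hQu : ((params N ε).Q : ℝ) < R * X + 1 := by
    rw [← e1]; exact Nat.ceil_lt_add_one (by positivity)
  have hB0 : (0 : ℝ) < (params N ε).B := by linarith
  have hNB : (N : ℝ) / (params N ε).B ≤ R * X := by
    rw [div_le_iff₀ hB0, eN]
    calc R ^ 2 = R * X * Y := by rw [eR]; ring
      _ ≤ _ := mul_le_mul_of_nonneg_left hBl (by positivity)
  set B : ℝ := ((params N ε).B : ℝ)
  set C : ℝ := ((params N ε).C : ℝ)
  set D : ℝ := ((params N ε).D : ℝ)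
  set K : ℝ := ((params N ε).K : ℝ)
  set S : ℝ := ((params N ε).S : ℝ)
  set Q : ℝ := ((params N ε).Q : ℝ)
  have e : (memBound (params N ε) : ℝ) =
      (S + B) + B * (C + K + 1) + (D + 1) + ((C * B + K) + 1) + (2 * D + Q + 1) + 4 := by
    have hW : (params N ε).W = 2 := rfl
    unfold memBound Params.midSize
    rw [hW]
    push_cast
    rfl
  rw [e]
  have hB2 : B ≤ 2 * Y := by linarith
  have hC0 : 0 ≤ C := Nat.cast_nonneg _
  have hK0 : 0 ≤ K := Nat.cast_nonneg _
  have hX1 : (1 : ℝ) ≤ X ^ 2 := one_le_pow₀ (by linarith)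
  have hX3 : X ^ 2 ≤ X ^ 3 := pow_le_pow_right₀ (by linarith) (by norm_num)
  have hC3 : C ≤ 3 * X ^ 2 := by
    have : (1 + ε) * X ^ 2 ≤ 2 * X ^ 2 := mul_le_mul_of_nonneg_right (by linarith) (sq_nonneg X)
    linarith
  have hK3 : K ≤ 2 * X ^ 3 := by linarith
  set Z := R * X ^ 2 with hZ
  have hZ1 : R * X ≤ Z :=
    mul_le_mul_of_nonneg_left (le_self_pow₀ (by linarith) (by norm_num)) hR0.le
  have hRX : R ≤ R * X := le_mul_of_one_le_right hR0.le (by linarith)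
  have hYR : Y ≤ R := by
    rw [eR]
    exact le_mul_of_one_le_right (by linarith) (by linarith)
  have t1 : B * (C + K + 1) ≤ 12 * Z := by
    calc B * (C + K + 1) ≤ (2 * Y) * (6 * X ^ 3) :=
          mul_le_mul hB2 (by linarith) (by linarith) (by linarith)
      _ = 12 * Z := by rw [hZ, eR]; ring
  have t2 : C * B ≤ 6 * Z := by
    calc C * B ≤ (3 * X ^ 2) * (2 * Y) := mul_le_mul hC3 hB2 hB0.le (by positivity)
      _ = 6 * (R * X) := by rw [eR]; ring
      _ ≤ _ := by linarith
  have t3 : K ≤ 2 * Z := by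
    calc K ≤ 2 * X ^ 3 := hK3
      _ = 2 * (X * X ^ 2) := by ring
      _ ≤ 2 * (R * X ^ 2) := by
        have := mul_le_mul_of_nonneg_right hXR (sq_nonneg X)
        linarith
  have t4 : R * X ^ 3 = X * Z := by rw [hZ]; ring
  rw [t4]
  have t5 : 60 * Z ≤ X * Z := mul_le_mul_of_nonneg_right hX (by positivity)
  linarith

theorem Large.privateMemory_mem (h : Large N ε) :
    (N : ℝ) ^ (1 / 2 - ε) ≤ privateMemory (params N ε) N ∧
      (privateMemory (params N ε) N : ℝ) ≤ (N : ℝ) ^ (1 / 2 + 3 * ε) :=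
  ⟨(Nat.le_ceil _).trans (Nat.cast_le.2 (le_privateMemory (params N ε) N)),
    (Nat.cast_le.2 (privateMemory_le _ _)).trans h.memBound_le⟩

theorem tendsto_log_natCast : Tendsto (fun N : ℕ => Real.log N) atTop atTop :=
  Real.tendsto_log_atTop.comp tendsto_natCast_atTop_atTop

/-- Only the constant 1 of the little-o is used: `log (log N) ≤ ε * log N` exponentiates to `log N ≤
N ^ ε`, and then `ε * N ^ ε ≥ ε * log N ≥ log (log N) ≥ 1`. -/
theorem Admissible.eventually_large {ε : ℕ → ℝ} (h : Admissible ε) :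
    ∀ᶠ N in atTop, Large N (ε N) := by
  obtain ⟨h1, h2, h3⟩ := h
  have h4 : ∀ᶠ N : ℕ in atTop, ε N ≤ 1 / 10 := h2.eventually (ge_mem_nhds (by norm_num))
  have h5 : ∀ᶠ N : ℕ in atTop, 60 ≤ Real.log N := tendsto_log_natCast.eventually_ge_atTop 60
  have h6 : ∀ᶠ N : ℕ in atTop, 1 ≤ Real.log (Real.log N) :=
    (Real.tendsto_log_atTop.comp tendsto_log_natCast).eventually_ge_atTop 1
  filter_upwards [h1, h3.def one_pos, h4, h5, h6] with N g1 g3 g4 g5 g6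
  have hl : 0 < Real.log N := by linarith
  rw [one_mul, Real.norm_of_nonneg g1.le, Real.norm_of_nonneg (by positivity)] at g3
  have hN0 : (0 : ℝ) < N := by
    have := Real.log_le_self (Nat.cast_nonneg (α := ℝ) N)
    linarith
  rw [div_le_iff₀ hl] at g3
  have hX : Real.log N ≤ (N : ℝ) ^ ε N := by
    rw [Real.rpow_def_of_pos hN0]
    calc Real.log N = Real.exp (Real.log (Real.log N)) := (Real.exp_log hl).symm
      _ ≤ _ := Real.exp_le_exp.2 (by linarith)
  refine ⟨g5, g1, g4, hX, ?_⟩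
  have := mul_le_mul_of_nonneg_left hX g1.le
  linarith

/-- The square root of a positive null sequence tends to zero and dominates the sequence. -/
theorem exists_admissible : ∃ ε : ℕ → ℝ, Admissible ε := by
  have hr : Tendsto (fun N : ℕ => Real.log (Real.log N) / Real.log N) atTop (𝓝 0) :=
    (Real.isLittleO_log_id_atTop.tendsto_div_nhds_zero).comp tendsto_log_natCast
  have h5 : ∀ᶠ N : ℕ in atTop, 0 < Real.log N := tendsto_log_natCast.eventually_gt_atTop 0
  have h6 : ∀ᶠ N : ℕ in atTop, 0 < Real.log (Real.log N) :=
    (Real.tendsto_log_atTop.comp tendsto_log_natCast).eventually_gt_atTop 0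
  have hpos : ∀ᶠ N : ℕ in atTop, 0 < Real.log (Real.log N) / Real.log N := by
    filter_upwards [h5, h6] with N h h'
    exact div_pos h' h
  have hs : Tendsto (fun N : ℕ => √(Real.log (Real.log N) / Real.log N)) atTop (𝓝 0) := by
    have := (Real.continuous_sqrt.tendsto 0).comp hr
    rwa [Real.sqrt_zero] at this
  refine ⟨fun N => √(Real.log (Real.log N) / Real.log N), ?_, hs, ?_⟩
  · filter_upwards [hpos] with N h
    exact Real.sqrt_pos.2 h
  · have h1 : (fun N : ℕ => √(Real.log (Real.log N) / Real.log N)) =o[atTop]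
        (fun _ => (1 : ℝ)) := (isLittleO_one_iff ℝ).2 hs
    have h2 := h1.mul_isBigO (isBigO_refl (fun N : ℕ => √(Real.log (Real.log N) / Real.log N)) atTop)
    refine h2.congr' ?_ (Eventually.of_forall fun N => one_mul _)
    filter_upwards [hpos] with N h
    exact Real.mul_self_sqrt h.le

end Asymptotics

end StashShuffle

/-! ### The theorem -/

theorem mainTheorem2 :
    (∃ ε : ℕ → ℝ, StashShuffle.Admissible ε) ∧
    ∀ ε : ℕ → ℝ, StashShuffle.Admissible ε →
      -- the shuffle is oblivious
      (∀ N : ℕ, StashShuffle.Oblivious (StashShuffle.params N (ε N)) N) ∧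
      -- private memory `N ^ (1/2 + o(1))`
      (∃ η : ℕ → ℝ, Tendsto η atTop (𝓝 0) ∧
        ∀ᶠ N : ℕ in atTop,
          (StashShuffle.privateMemory (StashShuffle.params N (ε N)) N : ℝ) =
            (N : ℝ) ^ (1 / 2 + η N)) ∧
      -- distance `N ^ (-ω(1))` from uniform, for every initial arrangement of the items
      (∃ g : ℕ → ℝ, Tendsto g atTop atTop ∧
        ∀ᶠ N : ℕ in atTop, ∀ x : Equiv.Perm (Fin N),
          StashShuffle.statDist (StashShuffle.outputLaw (StashShuffle.params N (ε N)) x)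
            (StashShuffle.uniformLaw N) ≤ (N : ℝ) ^ (-g N)) := by
  refine ⟨StashShuffle.exists_admissible, fun ε hε => ⟨fun N => StashShuffle.oblivious _ _, ?_, ?_⟩⟩
  · have hL := hε.eventually_large
    have h3 : Tendsto (fun N => 3 * ε N) atTop (𝓝 0) := by simpa using hε.2.1.const_mul 3
    have h1 : Tendsto (fun N => -ε N) atTop (𝓝 0) := by simpa using hε.2.1.neg
    -- The exponent is read off from the memory itself and squeezed between `-ε N` and `3 * ε N`.
    refine ⟨fun N => Real.log (StashShuffle.privateMemory (StashShuffle.params N (ε N)) N) /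
      Real.log N - 1 / 2, tendsto_of_tendsto_of_tendsto_of_le_of_le' h1 h3 ?_ ?_, ?_⟩
    · filter_upwards [hL] with N h
      have hN := h.sixty_le_N
      have hl : 0 < Real.log N := by linarith [h.log]
      have := Real.log_le_log (Real.rpow_pos_of_pos (by linarith) _) h.privateMemory_mem.1
      rw [Real.log_rpow (by linarith), ← le_div_iff₀ hl] at this
      linarith
    · filter_upwards [hL] with N h
      have hN := h.sixty_le_N
      have hl : 0 < Real.log N := by linarith [h.log]
      have hp := h.privateMemory_mem
      have := Real.log_le_log ((Real.rpow_pos_of_pos (by linarith) _).trans_le hp.1) hp.2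
      rw [Real.log_rpow (by linarith), ← div_le_iff₀ hl] at this
      linarith
    · filter_upwards [hL] with N h
      have hN := h.sixty_le_N
      have hl : 0 < Real.log N := by linarith [h.log]
      have hp := h.privateMemory_mem
      rw [add_sub_cancel, Real.rpow_def_of_pos (by linarith), mul_div_cancel₀ _ hl.ne',
        Real.exp_log ((Real.rpow_pos_of_pos (by linarith) _).trans_le hp.1)]
  · refine ⟨fun N => Real.log N / 64 - 4, ?_, ?_⟩
    · exact tendsto_atTop_add_const_right _ _
        (StashShuffle.tendsto_log_natCast.atTop_div_const (by norm_num))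
    · filter_upwards [hε.eventually_large] with N h x
      exact h.statDist_le x
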